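/- Let $X$ be a homogeneous Poisson process on $\mathbb R$ with intensity $\rho>0$, let $p\in(0,1]$ and $m\ge 1$, and let $X_p^1,\dots,X_p^m$ be independent $p$-thinnings of $X$: in $X_p^i$ each point of $X$ is retained with probability $p$, independently over all points and all $i$. For a point pattern $\mathbf x\subseteq\mathbb R$ and $x\in\mathbf x$ let $\mathcal V_x(\mathbf x)=\{u\in\mathbb R: |x-u|\le|y-u|\text{ for all }y\in\mathbf x\setminus\{x\}\}$ be the Voronoi cell of $x$ and $|\mathcal V_x(\mathbf x)|$ its length. The Voronoi intensity estimator $\widehat\rho^V(u;\mathbf x)$ is $1/|\mathcal V_x(\mathbf x)|$, where $\mathcal V_x(\mathbf x)$ is the cell containing $u$ (one of them, chosen by an arbitrary rule, if $u$ lies in several cells), and $\widehat\rho^V(u;\emptyset)=0$. Put $$\widehat\rho_{p,m}^V(u)=\frac1m\sum_{i=1}^m\frac{\widehat\rho^V(u;X_p^i)}{p},\qquad u\in\mathbb R,$$ and let $\widehat\rho_{p,1}^V(u)=\widehat\rho^V(u;X_p^j)/p$ be the same estimator based on a single one of the thinnings, for any $j$. (i) For each $i$, the size of the typical Voronoi cell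 of $X_p=X_p^i$ has the Erlang/Gamma distribution $\Gamma$ with shape $2$ and rate $2p\rho$; that is, for every bounded Borel set $W\subset\mathbb R$ of positive length and every Borel set $A\subseteq\mathbb R$, $$\mathbb E\big[\#\{x\in X_p\cap W: |\mathcal V_x(X_p)|\in A\}\big]=\Gamma(A)\,\mathbb E\big[\#(X_p\cap W)\big],\qquad 0<\mathbb E\big[\#(X_p\cap W)\big]<\infty.$$ (ii) For every $u\in\mathbb R$ and every $j\in\{1,\dots,m\}$, both estimators have finite variance and $$\operatorname{Var}(\widehat\rho_{p,m}^V(u))\le\operatorname{Var}(\widehat\rho_{p,1}^V(u))=\rho^2.$$ -/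

import Mathlib

open MeasureTheory ProbabilityTheory
open scoped ENNReal

/-- A point pattern on the real line: a locally finite set of points. -/
structure PointPattern where
  carrier : Set ℝ
  locallyFinite : ∀ A : Set ℝ, Bornology.IsBounded A → (carrier ∩ A).Finite

namespace PointPattern

/-- The number of points of `s` in `A`. It is used for bounded `A` only, where it is finite. -/
noncomputable def count (s : PointPattern) (A : Set ℝ) : ℕ := (s.carrier ∩ A).ncard

/-- The usual σ-algebra on point patterns, generated by the counts in bounded Borel sets. -/
noncomputable instance : MeasurableSpace PointPattern :=
  ⨆ (A : Set ℝ) (_ : MeasurableSet A) (_ : Bornology.IsBounded A),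
    MeasurableSpace.comap (fun s => s.count A) ⊤

/-- The Voronoi cell of `x` with respect to the pattern `s`, in the whole line. -/
def voronoiCell (s : PointPattern) (x : ℝ) : Set ℝ :=
  {u | ∀ y ∈ s.carrier \ {x}, dist x u ≤ dist y u}

/-- The length of the Voronoi cell of `x`. (A cell of infinite length gets the value `0`;
its reciprocal is then `0`, which agrees with the convention `1 / ∞ = 0`.) -/
noncomputable def cellSize (s : PointPattern) (x : ℝ) : ℝ := volume.real (s.voronoiCell x)

end PointPattern

/-- `X` is a homogeneous Poisson process on `ℝ` with intensity `ρ`. -/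
structure IsHomPoissonProcess {Ω : Type*} [MeasurableSpace Ω] (P : Measure Ω)
    (X : Ω → PointPattern) (ρ : ℝ) : Prop where
  measurable : Measurable X
  law_count : ∀ A : Set ℝ, MeasurableSet A → Bornology.IsBounded A →
    HasLaw (fun ω => (X ω).count A) (poissonMeasure (ρ * volume.real A).toNNReal) P
  indep_count : ∀ (n : ℕ) (A : Fin n → Set ℝ),
    (∀ j, MeasurableSet (A j)) → (∀ j, Bornology.IsBounded (A j)) →
    Pairwise (Function.onFun Disjoint A) →
    iIndepFun (fun j ω => (X ω).count (A j)) P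

/-- `Y 0, …, Y (m - 1)` are `m` independent `p`-thinnings of the point process `X`: the points of
`X` are enumerated without repetition as `ξ 0, ξ 1, …` (as many as there are points in `X`), and
`Y i` retains the point `ξ n` if and only if `B (i, n)` is true, where the `B (i, n)` are
i.i.d. Bernoulli variables with success probability `p`, independent of `X` and of its
enumeration. -/
structure AreIndepThinnings {Ω : Type*} [MeasurableSpace Ω] (P : Measure Ω)
    (X : Ω → PointPattern) (p : ℝ) {m : ℕ} (Y : Fin m → Ω → PointPattern) : Prop where
  measurable : ∀ i, Measurable (Y i)
  exists_marks : ∃ (ξ : ℕ → Ω → ℝ) (B : Fin m × ℕ → Ω → Bool),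
    (∀ n, Measurable (ξ n)) ∧ (∀ k, Measurable (B k)) ∧
    (∀ k, P {ω | B k ω = true} = ENNReal.ofReal p) ∧
    iIndepFun B P ∧
    IndepFun (fun ω => (X ω, fun n => ξ n ω)) (fun ω k => B k ω) P ∧
    ∀ᵐ ω ∂P,
      Set.InjOn (fun n => ξ n ω) {n : ℕ | (n : ℕ∞) < (X ω).carrier.encard} ∧
      (fun n => ξ n ω) '' {n : ℕ | (n : ℕ∞) < (X ω).carrier.encard} = (X ω).carrier ∧
      ∀ i, (Y i ω).carrier =
        (fun n => ξ n ω) '' {n : ℕ | (n : ℕ∞) < (X ω).carrier.encard ∧ B (i, n) ω = true}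

/-- `μ` is the distribution of the size of the typical Voronoi cell (the Palm distribution of the
cell size) of the point process `Y`: for every bounded Borel set `W` of positive length and every
Borel set `A`, the expected number of points of `Y` in `W` whose cell size lies in `A` is
`μ A` times the expected number of points of `Y` in `W`, which is positive and finite. -/
structure IsTypicalCellSizeLaw {Ω : Type*} [MeasurableSpace Ω] (P : Measure Ω)
    (Y : Ω → PointPattern) (μ : Measure ℝ) : Prop where
  isProbabilityMeasure : IsProbabilityMeasure μ
  mean_pos : ∀ W : Set ℝ, MeasurableSet W → Bornology.IsBounded W → 0 < volume W →
    0 < ∫⁻ ω, ((Y ω).count W : ℝ≥0∞) ∂P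
  mean_lt_top : ∀ W : Set ℝ, MeasurableSet W → Bornology.IsBounded W → 0 < volume W →
    ∫⁻ ω, ((Y ω).count W : ℝ≥0∞) ∂P < ∞
  palm : ∀ W : Set ℝ, MeasurableSet W → Bornology.IsBounded W → 0 < volume W →
    ∀ A : Set ℝ, MeasurableSet A →
      ∫⁻ ω, ((Y ω).count (W ∩ {x | (Y ω).cellSize x ∈ A}) : ℝ≥0∞) ∂P =
        (∫⁻ ω, ((Y ω).count W : ℝ≥0∞) ∂P) * μ A

/-- A rule that assigns to each location `u` a point of the pattern whose Voronoi cell contains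
`u`; it decides which cell is used where several cells meet. -/
def IsCellRule (c : PointPattern → ℝ → ℝ) : Prop :=
  ∀ (s : PointPattern) (u : ℝ), s.carrier.Nonempty →
    c s u ∈ s.carrier ∧ u ∈ s.voronoiCell (c s u)

open Classical in
/-- The Voronoi intensity estimator at `u`: the reciprocal size of the cell that contains `u`,
and `0` for the empty pattern. -/
noncomputable def voronoiEstimator (c : PointPattern → ℝ → ℝ) (s : PointPattern) (u : ℝ) : ℝ :=
  if s.carrier.Nonempty then 1 / s.cellSize (c s u) else 0

/-- The resample-smoothed Voronoi intensity estimator at `u`, from the thinned patterns `y`. -/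
noncomputable def resampleEstimator (c : PointPattern → ℝ → ℝ) (p : ℝ) {m : ℕ}
    (y : Fin m → PointPattern) (u : ℝ) : ℝ :=
  (1 / (m : ℝ)) * ∑ i, voronoiEstimator c (y i) u / p

open scoped NNReal

/-! Everything follows from one formula. Record each retained point together with its distances `L`
and `R` to the nearest retained points on its left and right. The intensity measure of these triples
is `p * ρ` times Lebesgue measure, times two independent exponential laws of rate `p * ρ`
(`sum_map_point_gaps`). To see this, condition on the positions: a point with `k` neighbours at
distance less than `s` on the left or `t` on the right is retained, with all of these deleted, with
probability `p (1-p)^k`. For points in a short interval, `k` is sandwiched between counts in fixed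
sets, whose generating functions are known; subdividing removes the error
(`measure_Ioc_eq_of_local_bounds`).

The cell of a retained point has length `V = (L + R) / 2`, which is gamma distributed with shape 2
and rate `2 * p * ρ`; this is (i). For (ii), almost surely exactly one cell contains `u`, so a
function of the estimator is a sum over retained points. Integrating out the position weights each
cell by its length: `E f(1/V_u) = p ρ E[f(1/V) V]`, where `V_u` is the length of the cell containing
`u`. Thus the moments are `p ρ` and `p ρ E[1/V] = 2 (p ρ)^2`, and after division by `p` the variance
is `ρ^2`. Averaging variables of equal mean and variance cannot increase the variance, whatever
their dependence. -/

/-! ### Generating functions of the Poisson law -/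

theorem lintegral_pow_poissonMeasure (r : ℝ≥0) {q : ℝ} (hq : 0 ≤ q) :
    ∫⁻ n, ENNReal.ofReal q ^ n ∂(poissonMeasure r) = ENNReal.ofReal (Real.exp (r * (q - 1))) := by
  have hs : HasSum (fun n : ℕ => Real.exp (-r) * r ^ n / n.factorial * q ^ n)
      (Real.exp (r * (q - 1))) := by
    have := (NormedSpace.expSeries_div_hasSum_exp (r * q : ℝ)).mul_left (Real.exp (-r))
    rw [← Real.exp_eq_exp_ℝ, ← Real.exp_add] at this
    convert! this using 1
    · ext n; rw [mul_pow]; ring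
    · congr 1; ring
  rw [poissonMeasure, lintegral_sum_measure]
  simp only [lintegral_smul_measure, lintegral_dirac, smul_eq_mul]
  rw [← hs.tsum_eq, ENNReal.ofReal_tsum_of_nonneg (fun n => by positivity) hs.summable]
  refine tsum_congr fun n => ?_
  rw [ENNReal.ofReal_mul (p := _ / _) (by positivity), ENNReal.ofReal_pow hq]

/-- This is the derivative of the generating function: cancelling `n` against `n!` and shifting the
index leaves `r` times the previous sum. The term `n = 0` vanishes, so the truncated `n - 1` is
harmless. -/
theorem lintegral_mul_pow_poissonMeasure (r : ℝ≥0) {q : ℝ} (hq : 0 ≤ q) :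
    ∫⁻ n : ℕ, (n : ℝ≥0∞) * ENNReal.ofReal q ^ (n - 1) ∂(poissonMeasure r) =
      ENNReal.ofReal (r * Real.exp (r * (q - 1))) := by
  have h := lintegral_pow_poissonMeasure r hq
  rw [poissonMeasure, lintegral_sum_measure] at h ⊢
  simp only [lintegral_smul_measure, lintegral_dirac, smul_eq_mul] at h ⊢
  rw [tsum_eq_zero_add' ENNReal.summable, ENNReal.ofReal_mul (by positivity), ← h,
    ← ENNReal.tsum_mul_left]
  simp only [Nat.cast_zero, zero_mul, mul_zero, zero_add, Nat.add_sub_cancel]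
  refine tsum_congr fun n => ?_
  rw [← mul_assoc, ← mul_assoc, ← ENNReal.ofReal_natCast (n + 1),
    ← ENNReal.ofReal_mul (by positivity), ← ENNReal.ofReal_mul (by positivity)]
  congr 2
  rw [Nat.factorial_succ]
  push_cast
  field_simp
  ring

/-! ### Sums of two independent exponential variables -/

theorem expMeasure_Ici {r : ℝ} (hr : 0 < r) (x : ℝ) :
    expMeasure r (Set.Ici x) = ENNReal.ofReal (Real.exp (-(r * max x 0))) := by
  have := isProbabilityMeasure_expMeasure hr
  have : NullSingletonClass (expMeasure r) := by
    unfold expMeasure gammaMeasure; infer_instance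
  have h := cdf_expMeasure_eq hr x
  rw [cdf_eq_real] at h
  rw [← measure_congr (Ioi_ae_eq_Ici (a := x)), ← Set.compl_Iic,
    ← ofReal_measureReal, probReal_compl_eq_one_sub measurableSet_Iic, h]
  split_ifs with hx
  · rw [max_eq_left hx]; congr 1; ring
  · rw [max_eq_right (by linarith)]; simp

theorem measurable_gammaPDF (a r : ℝ) : Measurable (gammaPDF a r) :=
  (measurable_gammaPDFReal a r).ennreal_ofReal

theorem lintegral_gammaMeasure (a r : ℝ) {g : ℝ → ℝ≥0∞} (hg : Measurable g) :
    ∫⁻ x, g x ∂(gammaMeasure a r) = ∫⁻ x, gammaPDF a r x * g x := by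
  rw [gammaMeasure, lintegral_withDensity_eq_lintegral_mul _ (measurable_gammaPDF a r) hg]
  rfl

/-- In the convolution the product of the two densities at `x` and `v - x` is constant in `x` on
`[0, v]`, so the inner integral only contributes the length `v`. -/
theorem lintegral_add_expMeasure_prod {r : ℝ} (hr : 0 < r) {g : ℝ → ℝ≥0∞} (hg : Measurable g) :
    ∫⁻ z, g (z.1 + z.2) ∂((expMeasure r).prod (expMeasure r)) =
      ∫⁻ v in Set.Ici 0, ENNReal.ofReal (r ^ 2 * v * Real.exp (-(r * v))) * g v := by
  have := isProbabilityMeasure_expMeasure hr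
  have hm := measurable_gammaPDF 1 r
  have hprod (x v : ℝ) : gammaPDF 1 r x * gammaPDF 1 r (v - x) =
      (Set.Icc 0 v).indicator (fun _ => ENNReal.ofReal (r ^ 2 * Real.exp (-(r * v)))) x := by
    change exponentialPDF r x * exponentialPDF r (v - x) = _
    rw [exponentialPDF_eq, exponentialPDF_eq]
    by_cases h1 : 0 ≤ x
    · by_cases h2 : x ≤ v
      · rw [if_pos h1, if_pos (by linarith), Set.indicator_of_mem (Set.mem_Icc.2 ⟨h1, h2⟩),
          ← ENNReal.ofReal_mul (by positivity)]
        congr 1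
        rw [show -(r * v) = -(r * x) + -(r * (v - x)) by ring, Real.exp_add]
        ring
      · rw [if_neg (c := 0 ≤ v - x) (by linarith), Set.indicator_of_notMem (fun h => h2 h.2)]
        simp
    · rw [if_neg h1, Set.indicator_of_notMem (fun h => h1 h.1)]
      simp
  rw [lintegral_prod _ (by fun_prop)]
  simp only [expMeasure]
  calc ∫⁻ x, ∫⁻ y, g (x + y) ∂(gammaMeasure 1 r) ∂(gammaMeasure 1 r)
      = ∫⁻ x, gammaPDF 1 r x * ∫⁻ y, gammaPDF 1 r y * g (x + y) := by
        rw [lintegral_gammaMeasure]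
        · refine lintegral_congr fun x => ?_
          rw [lintegral_gammaMeasure _ _ (by fun_prop)]
        · have : SFinite (gammaMeasure 1 r) := by unfold gammaMeasure; infer_instance
          exact Measurable.lintegral_prod_right' (f := fun z : ℝ × ℝ => g (z.1 + z.2)) (by fun_prop)
    _ = ∫⁻ x, ∫⁻ v, gammaPDF 1 r x * gammaPDF 1 r (v - x) * g v := by
        refine lintegral_congr fun x => ?_
        rw [← lintegral_const_mul _ (by fun_prop),
          ← lintegral_sub_right_eq_self (fun y => gammaPDF 1 r x * (gammaPDF 1 r y * g (x + y))) x]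
        refine lintegral_congr fun v => ?_
        rw [add_sub_cancel, mul_assoc]
    _ = ∫⁻ v, ∫⁻ x, gammaPDF 1 r x * gammaPDF 1 r (v - x) * g v :=
        lintegral_lintegral_swap (by fun_prop)
    _ = _ := by
        rw [← lintegral_indicator measurableSet_Ici]
        refine lintegral_congr fun v => ?_
        simp only [hprod]
        rw [lintegral_mul_const _ (measurable_const.indicator measurableSet_Icc),
          lintegral_indicator measurableSet_Icc, setLIntegral_const, Real.volume_Icc]
        by_cases hv : 0 ≤ v
        · rw [Set.indicator_of_mem (show v ∈ Set.Ici 0 from hv),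
            ← ENNReal.ofReal_mul (by positivity), sub_zero]
          congr 2; ring
        · rw [Set.indicator_of_notMem (show v ∉ Set.Ici 0 from hv),
            ENNReal.ofReal_of_nonpos (p := v - 0) (by linarith)]
          simp

theorem lintegral_eq_two_mul_lintegral_comp_two_mul {f : ℝ → ℝ≥0∞} (hf : Measurable f) :
    ∫⁻ x, f x = 2 * ∫⁻ x, f (2 * x) := by
  rw [← lintegral_map (g := fun x : ℝ => 2 * x) hf (by fun_prop), Real.map_volume_mul_left two_ne_zero,
    lintegral_smul_measure, smul_eq_mul, ← mul_assoc, ← ENNReal.ofReal_ofNat 2,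
    ← ENNReal.ofReal_mul (by norm_num)]
  norm_num

/-- Substituting `v = 2w` in the density of the sum gives `(2r)^2 w exp(-2rw)`: halving doubles the
rate. -/
theorem expMeasure_prod_half_add {r : ℝ} (hr : 0 < r) {A : Set ℝ} (hA : MeasurableSet A) :
    ((expMeasure r).prod (expMeasure r)) {z | (z.1 + z.2) / 2 ∈ A} =
      gammaMeasure 2 (2 * r) A := by
  have hA' : MeasurableSet {v : ℝ | v / 2 ∈ A} := hA.preimage (by fun_prop)
  have hS : MeasurableSet {z : ℝ × ℝ | (z.1 + z.2) / 2 ∈ A} := hA.preimage (by fun_prop)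
  have h := lintegral_add_expMeasure_prod hr
    (g := {v : ℝ | v / 2 ∈ A}.indicator 1) (measurable_one.indicator hA')
  rw [← lintegral_indicator_one hS]
  refine Eq.trans (lintegral_congr fun z => ?_) (h.trans ?_)
  · rfl
  rw [← lintegral_indicator_one hA, lintegral_gammaMeasure _ _ (measurable_one.indicator hA),
    ← lintegral_indicator measurableSet_Ici]
  rw [lintegral_eq_two_mul_lintegral_comp_two_mul, ← lintegral_const_mul' _ _ (by simp)]
  · refine lintegral_congr fun w => ?_
    have hi : {v : ℝ | v / 2 ∈ A}.indicator (1 : ℝ → ℝ≥0∞) (2 * w) = A.indicator 1 w := by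
      have hiff : 2 * w ∈ {v : ℝ | v / 2 ∈ A} ↔ w ∈ A := by simp
      by_cases h : w ∈ A
      · rw [Set.indicator_of_mem h, Set.indicator_of_mem (hiff.2 h)]; simp
      · rw [Set.indicator_of_notMem h, Set.indicator_of_notMem (fun h' => h (hiff.1 h'))]
    by_cases hw : 0 ≤ w
    · rw [Set.indicator_of_mem (by simpa using hw), hi, gammaPDF_of_nonneg hw, ← mul_assoc,
        ← ENNReal.ofReal_ofNat 2, ← ENNReal.ofReal_mul (by norm_num), Real.Gamma_two,
        Real.rpow_two, show (2 : ℝ) - 1 = 1 by norm_num, Real.rpow_one]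
      congr 2
      rw [show r * (2 * w) = 2 * r * w by ring]; ring
    · rw [Set.indicator_of_notMem (by simpa using hw), gammaPDF_of_neg (by linarith)]
      simp
  · exact Measurable.indicator (Measurable.mul (by fun_prop) (measurable_one.indicator hA'))
      measurableSet_Ici

/-- The factor `1 / v` cancels the `v` in the density of the sum and leaves `r` times an exponential
density. -/
theorem lintegral_inv_add_expMeasure_prod {r : ℝ} (hr : 0 < r) :
    ∫⁻ z, ENNReal.ofReal (1 / (z.1 + z.2)) ∂((expMeasure r).prod (expMeasure r)) =
      ENNReal.ofReal r := by
  rw [lintegral_add_expMeasure_prod hr (g := fun v => ENNReal.ofReal (1 / v)) (by fun_prop)]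
  rw [← one_mul (ENNReal.ofReal r), ← lintegral_exponentialPDF_eq_one hr,
    ← lintegral_mul_const (f := exponentialPDF r) _ (measurable_gammaPDF 1 r), ← setLIntegral_congr Ioi_ae_eq_Ici,
    ← lintegral_indicator measurableSet_Ioi]
  refine lintegral_congr_ae ?_
  have h0 : ∀ᵐ v : ℝ, v ≠ 0 := by simp [ae_iff]
  filter_upwards [h0] with v hv
  rw [exponentialPDF_eq]
  rcases lt_or_gt_of_ne hv with h | h
  · rw [if_neg (by linarith), Set.indicator_of_notMem (by simpa using h.le)]; simp
  · rw [if_pos h.le, Set.indicator_of_mem (by simpa using h),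
      ← ENNReal.ofReal_mul (by positivity), ← ENNReal.ofReal_mul (by positivity)]
    congr 1; field_simp

/-! ### Identifying measures from local bounds and from rectangles -/

/-- Cut `(a, b]` into equal pieces of length `δ`. The bounds add up with the common factors
`exp(±αδ)`, which tend to 1 as the pieces shrink. -/
theorem measure_Ioc_eq_of_local_bounds {ν : Measure ℝ} {κ α : ℝ} (hκ : 0 ≤ κ)
    (hl : ∀ c δ : ℝ, 0 ≤ δ →
      ENNReal.ofReal (κ * δ * Real.exp (-(α * δ))) ≤ ν (Set.Ioc c (c + δ)))
    (hu : ∀ c δ : ℝ, 0 ≤ δ → ν (Set.Ioc c (c + δ)) ≤ ENNReal.ofReal (κ * δ * Real.exp (α * δ)))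
    (a b : ℝ) : ν (Set.Ioc a b) = ENNReal.ofReal (κ * (b - a)) := by
  rcases le_total b a with hab | hab
  · rw [Set.Ioc_eq_empty (by linarith), measure_empty,
      ENNReal.ofReal_of_nonpos (mul_nonpos_of_nonneg_of_nonpos hκ (by linarith))]
  have split (δ : ℝ) (hδ : 0 ≤ δ) (N : ℕ) : ν (Set.Ioc a (a + (N + 1 : ℕ) * δ)) =
      ν (Set.Ioc a (a + N * δ)) + ν (Set.Ioc (a + N * δ) (a + N * δ + δ)) := by
    have h0 : 0 ≤ N * δ := by positivity
    rw [← measure_union (Set.Ioc_disjoint_Ioc_of_le le_rfl) measurableSet_Ioc,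
      Set.Ioc_union_Ioc_eq_Ioc (by linarith) (by linarith)]
    congr 2; push_cast; ring
  have lower (δ : ℝ) (hδ : 0 ≤ δ) (N : ℕ) :
      ENNReal.ofReal (κ * (N * δ) * Real.exp (-(α * δ))) ≤ ν (Set.Ioc a (a + N * δ)) := by
    induction N with
    | zero => simp
    | succ N ih =>
      rw [split δ hδ]
      refine le_trans (le_of_eq ?_) (add_le_add ih (hl _ δ hδ))
      rw [← ENNReal.ofReal_add (by positivity) (by positivity)]
      congr 1; push_cast; ring
  have upper (δ : ℝ) (hδ : 0 ≤ δ) (N : ℕ) :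
      ν (Set.Ioc a (a + N * δ)) ≤ ENNReal.ofReal (κ * (N * δ) * Real.exp (α * δ)) := by
    induction N with
    | zero => simp
    | succ N ih =>
      rw [split δ hδ]
      refine le_trans (add_le_add ih (hu _ δ hδ)) (le_of_eq ?_)
      rw [← ENNReal.ofReal_add (by positivity) (by positivity)]
      congr 1; push_cast; ring
  have hN (N : ℕ) : a + (N + 1 : ℕ) * ((b - a) / (N + 1 : ℕ)) = b := by field_simp; ring
  have hN' (N : ℕ) : (N + 1 : ℕ) * ((b - a) / (N + 1 : ℕ)) = b - a := by field_simp
  have hpos (N : ℕ) : 0 ≤ (b - a) / (N + 1 : ℕ) := div_nonneg (by linarith) (by positivity)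
  have hlim : Filter.Tendsto (fun N : ℕ => (b - a) / (N + 1 : ℕ)) Filter.atTop (nhds 0) :=
    (tendsto_const_div_atTop_nhds_zero_nat (b - a)).comp (Filter.tendsto_add_atTop_nat 1)
  have hlim' (β : ℝ) : Filter.Tendsto
      (fun N : ℕ => ENNReal.ofReal (κ * (b - a) * Real.exp (β * ((b - a) / (N + 1 : ℕ)))))
      Filter.atTop (nhds (ENNReal.ofReal (κ * (b - a)))) := by
    refine ENNReal.tendsto_ofReal ?_
    have := ((Real.continuous_exp.tendsto _).comp (hlim.const_mul β)).const_mul (κ * (b - a))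
    simpa using this
  apply le_antisymm
  · refine ge_of_tendsto' (hlim' α) fun N => ?_
    have := upper _ (hpos N) (N + 1)
    rwa [hN, hN'] at this
  · refine le_of_tendsto' (hlim' (-α)) fun N => ?_
    have := lower _ (hpos N) (N + 1)
    rw [hN, hN'] at this
    rwa [neg_mul]

-- These boxes form a generating π-system covered by countably many sets of finite measure. The
-- thresholds range over all of `ℝ`, negative ones included, so that the half-lines exhaust the
-- line; `max` reflects that the exponential law lives on `[0, ∞)`.
open Set in
theorem eq_prod_expMeasure_of_rectangles {M : Measure (ℝ × ℝ × ℝ)} {r : ℝ} (hr : 0 < r)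
    (h : ∀ a b s t : ℝ, M (Ioc a b ×ˢ (Ici s ×ˢ Ici t)) =
      ENNReal.ofReal (r * Real.exp (-(r * (max s 0 + max t 0))) * (b - a))) :
    M = (ENNReal.ofReal r • volume).prod ((expMeasure r).prod (expMeasure r)) := by
  have := isProbabilityMeasure_expMeasure hr
  have hE : MeasurableSpace.generateFrom (range (Ici : ℝ → Set ℝ)) = Real.measurableSpace := by
    rw [← borel_eq_generateFrom_Ici]; exact (BorelSpace.measurable_eq).symm
  have hIspan : ⋃ i : ℕ, Ici (-(i : ℝ)) = univ := by
    refine eq_univ_of_forall fun x => mem_iUnion.2 ?_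
    obtain ⟨n, hn⟩ := exists_nat_ge (-x)
    exact ⟨n, by simp only [mem_Ici]; linarith⟩
  have hspan : IsCountablySpanning (range (Ici : ℝ → Set ℝ)) :=
    ⟨fun n => Ici (-(n : ℝ)), fun n => mem_range_self _, hIspan⟩
  symm
  refine Measure.prod_eq_generateFrom (C := {S | ∃ l u : ℝ, l < u ∧ Ioc l u = S})
    (D := image2 (· ×ˢ ·) (range Ici) (range Ici)) ?_ ?_ ?_ ?_ ?_ ?_ ?_
  · rw [← borel_eq_generateFrom_Ioc]; exact (BorelSpace.measurable_eq).symm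
  · exact generateFrom_eq_prod hE hE hspan hspan
  · exact isPiSystem_Ioc id id
  · exact isPiSystem_Ici.prod isPiSystem_Ici
  · refine ⟨fun n => Ioc (-(n + 1 : ℝ)) (n + 1), fun n => ⟨_, _, ?_, rfl⟩, fun n => ?_, ?_⟩
    · have : (0 : ℝ) ≤ n := by positivity
      change (-(n + 1) : ℝ) < n + 1; linarith
    · simp [ENNReal.mul_lt_top]
    · refine eq_univ_of_forall fun x => mem_iUnion.2 ?_
      obtain ⟨n, hn⟩ := exists_nat_gt |x|
      exact ⟨n, by linarith [neg_abs_le x], by linarith [le_abs_self x]⟩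
  · refine ⟨fun n => Ici (-(n : ℝ)) ×ˢ Ici (-(n : ℝ)), fun n => ⟨_, mem_range_self _, _,
      mem_range_self _, rfl⟩, fun n => measure_lt_top _ _, ?_⟩
    refine eq_univ_of_forall fun x => mem_iUnion.2 ?_
    obtain ⟨n, hn⟩ := exists_nat_ge (max (-x.1) (-x.2))
    exact ⟨n, by simp only [mem_Ici]; linarith [le_max_left (-x.1) (-x.2)],
      by simp only [mem_Ici]; linarith [le_max_right (-x.1) (-x.2)]⟩
  · rintro _ ⟨a, b, hab, rfl⟩ _ ⟨_, ⟨s, rfl⟩, _, ⟨t, rfl⟩, rfl⟩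
    rw [h, Measure.prod_prod, expMeasure_Ici hr, expMeasure_Ici hr, Measure.smul_apply,
      Real.volume_Ioc, smul_eq_mul, ← ENNReal.ofReal_mul hr.le,
      ← ENNReal.ofReal_mul (Real.exp_nonneg _), ← ENNReal.ofReal_mul (mul_nonneg hr.le (sub_nonneg.2 hab.le)),
      ← Real.exp_add]
    congr 1
    rw [mul_right_comm]; congr 3; ring

/-! ### Gaps between marked points and Voronoi cells -/

/-- The distance from `x n` to the next of the points `x k` with `b k = true` on its right. -/
noncomputable def rightGap (x : ℕ → ℝ) (b : ℕ → Bool) (n : ℕ) : ℝ≥0∞ :=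
  ⨅ k, ⨅ (_ : b k = true ∧ x n < x k), ENNReal.ofReal (x k - x n)

/-- The distance from `x n` to the next of the points `x k` with `b k = true` on its left. -/
noncomputable def leftGap (x : ℕ → ℝ) (b : ℕ → Bool) (n : ℕ) : ℝ≥0∞ :=
  rightGap (fun k => -x k) b n

theorem ofReal_le_rightGap_iff {x : ℕ → ℝ} {b : ℕ → Bool} {n : ℕ} {t : ℝ} :
    ENNReal.ofReal t ≤ rightGap x b n ↔ ∀ k, b k = true → x n < x k → x n + t ≤ x k := by
  simp only [rightGap, le_iInf_iff, and_imp]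
  refine forall_congr' fun k => forall_congr' fun _ => forall_congr' fun h => ?_
  rw [ENNReal.ofReal_le_ofReal_iff (by linarith), le_sub_iff_add_le']

theorem ofReal_le_leftGap_iff {x : ℕ → ℝ} {b : ℕ → Bool} {n : ℕ} {t : ℝ} :
    ENNReal.ofReal t ≤ leftGap x b n ↔ ∀ k, b k = true → x k < x n → x k ≤ x n - t := by
  rw [leftGap, ofReal_le_rightGap_iff]
  refine forall_congr' fun k => forall_congr' fun _ => ?_
  rw [neg_lt_neg_iff]
  refine forall_congr' fun h => ?_
  constructor <;> intro <;> linarith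

theorem measurable_rightGap {Ω : Type*} [MeasurableSpace Ω] {ξ : ℕ → Ω → ℝ} {B : ℕ → Ω → Bool}
    (hξ : ∀ k, Measurable (ξ k)) (hB : ∀ k, Measurable (B k)) (n : ℕ) :
    Measurable fun ω => rightGap (fun k => ξ k ω) (fun k => B k ω) n := by
  classical
  refine Measurable.iInf fun k => ?_
  simp only [iInf_eq_if]
  refine Measurable.ite ?_ (((hξ k).sub (hξ n)).ennreal_ofReal) measurable_const
  exact (hB k (measurableSet_singleton true)).inter (measurableSet_lt (hξ n) (hξ k))

theorem measurable_leftGap {Ω : Type*} [MeasurableSpace Ω] {ξ : ℕ → Ω → ℝ} {B : ℕ → Ω → Bool}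
    (hξ : ∀ k, Measurable (ξ k)) (hB : ∀ k, Measurable (B k)) (n : ℕ) :
    Measurable fun ω => leftGap (fun k => ξ k ω) (fun k => B k ω) n :=
  measurable_rightGap (fun k => (hξ k).neg) hB n

namespace PointPattern

/-- Each point on one side confines the cell to its side of a midpoint, and the nearest marked point
on that side gives the tightest constraint. -/
theorem voronoiCell_eq_Icc {s : PointPattern} {x : ℕ → ℝ} {b : ℕ → Bool}
    (hs : s.carrier = x '' {k | b k = true}) {n : ℕ}
    (hL : leftGap x b n ≠ ∞) (hR : rightGap x b n ≠ ∞) :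
    s.voronoiCell (x n) =
      Set.Icc (x n - (leftGap x b n).toReal / 2) (x n + (rightGap x b n).toReal / 2) := by
  -- The difference of squared distances to `u` factors as `(y - x n) * (y + x n - 2 * u)`.
  have key (y u : ℝ) : dist (x n) u ≤ dist y u ↔ 0 ≤ (y - x n) * (y + x n - 2 * u) := by
    rw [Real.dist_eq, Real.dist_eq, ← sq_le_sq]
    constructor <;> intro h <;> nlinarith
  ext u
  have hr := (ENNReal.ofReal_le_iff_le_toReal (a := 2 * (u - x n)) hR).symm.trans
    ofReal_le_rightGap_iff
  have hl := (ENNReal.ofReal_le_iff_le_toReal (a := 2 * (x n - u)) hL).symm.trans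
    ofReal_le_leftGap_iff
  simp only [voronoiCell, Set.mem_ofPred_eq, Set.mem_Icc, hs]
  rw [show x n - (leftGap x b n).toReal / 2 ≤ u ↔ 2 * (x n - u) ≤ (leftGap x b n).toReal by
      constructor <;> intro <;> linarith,
    show u ≤ x n + (rightGap x b n).toReal / 2 ↔ 2 * (u - x n) ≤ (rightGap x b n).toReal by
      constructor <;> intro <;> linarith, hr, hl]
  constructor
  · refine fun h => ⟨fun k hk hkn => ?_, fun k hk hkn => ?_⟩
    · have := (key (x k) u).1 (h _ ⟨⟨k, hk, rfl⟩, hkn.ne⟩)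
      nlinarith
    · have := (key (x k) u).1 (h _ ⟨⟨k, hk, rfl⟩, hkn.ne'⟩)
      nlinarith
  · rintro ⟨h1, h2⟩ _ ⟨⟨k, hk, rfl⟩, hkn⟩
    rw [key]
    rcases lt_or_gt_of_ne (show x k ≠ x n from hkn) with h | h
    · have := h1 k hk h
      nlinarith
    · have := h2 k hk h
      nlinarith

theorem cellSize_eq {s : PointPattern} {x : ℕ → ℝ} {b : ℕ → Bool}
    (hs : s.carrier = x '' {k | b k = true}) {n : ℕ}
    (hL : leftGap x b n ≠ ∞) (hR : rightGap x b n ≠ ∞) :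
    s.cellSize (x n) = ((leftGap x b n).toReal + (rightGap x b n).toReal) / 2 := by
  have h1 := (leftGap x b n).toReal_nonneg
  have h2 := (rightGap x b n).toReal_nonneg
  rw [cellSize, voronoiCell_eq_Icc hs hL hR, Real.volume_real_Icc_of_le (by linarith)]
  ring

theorem count_eq_tsum {s : PointPattern} {x : ℕ → ℝ} (hx : x.Injective) {N : Set ℕ}
    (hs : s.carrier = x '' N) {W : Set ℝ} (hW : Bornology.IsBounded W) :
    (s.count W : ℝ≥0∞) = ∑' n, {n | n ∈ N ∧ x n ∈ W}.indicator 1 n := by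
  have himg : s.carrier ∩ W = x '' {n | n ∈ N ∧ x n ∈ W} := by
    rw [hs]; ext y; constructor
    · rintro ⟨⟨n, hn, rfl⟩, hy⟩; exact ⟨n, ⟨hn, hy⟩, rfl⟩
    · rintro ⟨n, ⟨hn, hy⟩, rfl⟩; exact ⟨⟨n, hn, rfl⟩, hy⟩
  -- Finiteness matters because `ncard` is 0 on infinite sets.
  have hfin : {n | n ∈ N ∧ x n ∈ W}.Finite :=
    Set.Finite.of_finite_image (himg ▸ s.locallyFinite W hW) hx.injOn
  rw [count, himg, Set.ncard_image_of_injective _ hx, ← tsum_subtype]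
  simp only [Pi.one_apply]
  rw [ENNReal.tsum_set_one, ← hfin.cast_ncard_eq]
  simp

/-- Away from cell endpoints `u` lies in just one cell, so the sum has a single nonzero term and the
tie-breaking rule plays no role. The condition `f 0 = 0` covers the empty pattern. -/
theorem apply_voronoiEstimator_eq_tsum {c : PointPattern → ℝ → ℝ} (hc : IsCellRule c)
    {s : PointPattern} {x : ℕ → ℝ} {b : ℕ → Bool} (hx : x.Injective)
    (hs : s.carrier = x '' {k | b k = true}) {u : ℝ}
    (hfin : ∀ n, b n = true → leftGap x b n ≠ ∞ ∧ rightGap x b n ≠ ∞)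
    (hu : ∀ n, b n = true → u ≠ x n - (leftGap x b n).toReal / 2 ∧
      u ≠ x n + (rightGap x b n).toReal / 2)
    {f : ℝ → ℝ≥0∞} (hf : f 0 = 0) :
    f (voronoiEstimator c s u) = ∑' n, if b n = true then
      (if x n - (leftGap x b n).toReal / 2 ≤ u ∧ u ≤ x n + (rightGap x b n).toReal / 2 then
        f (2 / ((leftGap x b n).toReal + (rightGap x b n).toReal)) else 0) else 0 := by
  by_cases hne : s.carrier.Nonempty
  · obtain ⟨hmem, hcell⟩ := hc s u hne
    rw [hs] at hmem
    obtain ⟨n, hn, hnx⟩ := hmem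
    replace hn : b n = true := hn
    rw [← hnx] at hcell
    have hIcc := hcell
    rw [voronoiCell_eq_Icc hs (hfin n hn).1 (hfin n hn).2] at hIcc
    rw [tsum_eq_single n, if_pos hn, if_pos (Set.mem_Icc.1 hIcc), voronoiEstimator, if_pos hne, ← hnx,
      cellSize_eq hs (hfin n hn).1 (hfin n hn).2, one_div_div]
    intro k hkn
    split_ifs with hk hku
    · exfalso
      have hxne : x k ≠ x n := hx.ne hkn
      have hkcell : u ∈ s.voronoiCell (x k) := by
        rw [voronoiCell_eq_Icc hs (hfin k hk).1 (hfin k hk).2]; exact hku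
      have h1 : dist (x n) u ≤ dist (x k) u :=
        hcell _ ⟨hs ▸ ⟨k, hk, rfl⟩, hxne⟩
      have h2 : dist (x k) u ≤ dist (x n) u :=
        hkcell _ ⟨hs ▸ ⟨n, hn, rfl⟩, hxne.symm⟩
      -- If two cells contain `u`, then `u` is the midpoint of their points. The gap bound then
      -- forces `u` onto the endpoint of the cell of `x n`, which `hu` excludes.
      have hmid : x k - u = -(x n - u) := by
        rcases abs_eq_abs.1 (le_antisymm h2 h1) with h | h
        · exact absurd (by linarith) hxne
        · exact h
      rcases lt_or_gt_of_ne hxne with h | h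
      · have := ofReal_le_leftGap_iff.1 (ENNReal.ofReal_toReal (hfin n hn).1).le k hk h
        exact (hu n hn).1 (by linarith [hIcc.1])
      · have := ofReal_le_rightGap_iff.1 (ENNReal.ofReal_toReal (hfin n hn).2).le k hk h
        exact (hu n hn).2 (by linarith [hIcc.2])
    · rfl
    · rfl
  · rw [voronoiEstimator, if_neg hne, hf]
    refine (ENNReal.tsum_eq_zero.2 fun n => ?_).symm
    rw [if_neg]
    exact fun h => hne (hs ▸ ⟨x n, n, h, rfl⟩)

end PointPattern

/-! ### Counts of the Poisson process -/

theorem PointPattern.measurable_count {A : Set ℝ} (hA : MeasurableSet A)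
    (hb : Bornology.IsBounded A) : Measurable fun s : PointPattern => s.count A :=
  measurable_iff_comap_le.2 <|
    le_iSup_of_le (f := fun A : Set ℝ => ⨆ (_ : MeasurableSet A) (_ : Bornology.IsBounded A),
      MeasurableSpace.comap (fun s : PointPattern => s.count A) ⊤) A <|
      le_iSup_of_le hA <| le_iSup_of_le hb le_rfl

namespace IsHomPoissonProcess

variable {Ω : Type*} [MeasurableSpace Ω] {P : Measure Ω} {X : Ω → PointPattern} {ρ : ℝ}

theorem lintegral_pow_count (hX : IsHomPoissonProcess P X ρ) (hρ : 0 ≤ ρ) {A : Set ℝ}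
    (hA : MeasurableSet A) (hb : Bornology.IsBounded A) {q : ℝ} (hq : 0 ≤ q) :
    ∫⁻ ω, ENNReal.ofReal q ^ (X ω).count A ∂P =
      ENNReal.ofReal (Real.exp (ρ * volume.real A * (q - 1))) := by
  rw [(hX.law_count A hA hb).lintegral_comp (f := fun n => ENNReal.ofReal q ^ n) (by fun_prop),
    lintegral_pow_poissonMeasure _ hq, Real.coe_toNNReal _ (by positivity)]

theorem lintegral_count_mul_pow (hX : IsHomPoissonProcess P X ρ) (hρ : 0 ≤ ρ) {A : Set ℝ}
    (hA : MeasurableSet A) (hb : Bornology.IsBounded A) {q : ℝ} (hq : 0 ≤ q) :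
    ∫⁻ ω, ((X ω).count A : ℝ≥0∞) * ENNReal.ofReal q ^ ((X ω).count A - 1) ∂P =
      ENNReal.ofReal (ρ * volume.real A * Real.exp (ρ * volume.real A * (q - 1))) := by
  rw [(hX.law_count A hA hb).lintegral_comp
    (f := fun n : ℕ => (n : ℝ≥0∞) * ENNReal.ofReal q ^ (n - 1)) (by fun_prop),
    lintegral_mul_pow_poissonMeasure _ hq, Real.coe_toNNReal _ (by positivity)]

theorem lintegral_count_mul_pow_mul_pow (hX : IsHomPoissonProcess P X ρ) (hρ : 0 ≤ ρ)
    {A A' : Set ℝ} (hA : MeasurableSet A) (hb : Bornology.IsBounded A) (hA' : MeasurableSet A')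
    (hb' : Bornology.IsBounded A') (hd : Disjoint A A') {q q' : ℝ} (hq : 0 ≤ q) (hq' : 0 ≤ q') :
    ∫⁻ ω, ((X ω).count A : ℝ≥0∞) * ENNReal.ofReal q ^ ((X ω).count A - 1) *
        ENNReal.ofReal q' ^ (X ω).count A' ∂P =
      ENNReal.ofReal (ρ * volume.real A * Real.exp (ρ * volume.real A * (q - 1)) *
        Real.exp (ρ * volume.real A' * (q' - 1))) := by
  have hi := hX.indep_count 2 ![A, A'] (by simp [Fin.forall_fin_two, hA, hA'])
    (by simp [Fin.forall_fin_two, hb, hb'])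
    (by simp [Pairwise, Fin.forall_fin_two, Function.onFun, hd, hd.symm])
  have hij : IndepFun (fun ω => (X ω).count A) (fun ω => (X ω).count A') P := by
    simpa using hi.indepFun (show (0 : Fin 2) ≠ 1 by decide)
  have hc := (PointPattern.measurable_count hA hb).comp hX.measurable
  have hc' := (PointPattern.measurable_count hA' hb').comp hX.measurable
  let φ : ℕ → ℝ≥0∞ := fun n => (n : ℝ≥0∞) * ENNReal.ofReal q ^ (n - 1)
  let ψ : ℕ → ℝ≥0∞ := fun n => ENNReal.ofReal q' ^ n
  have h := hij.comp (φ := φ) (ψ := ψ) .of_discrete .of_discrete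
  have hφ : Measurable (φ ∘ fun ω => (X ω).count A) := Measurable.of_discrete.comp hc
  have hψ : Measurable (ψ ∘ fun ω => (X ω).count A') := Measurable.of_discrete.comp hc'
  have := lintegral_mul_eq_lintegral_mul_lintegral_of_indepFun'' hφ.aemeasurable hψ.aemeasurable h
  simp only [Function.comp_apply, φ, ψ] at this
  rw [this, hX.lintegral_count_mul_pow hρ hA hb hq, hX.lintegral_pow_count hρ hA' hb' hq',
    ← ENNReal.ofReal_mul (by positivity)]

/-- Markov's inequality applied to `(1/2)^count` on `[-N, N]`, whose mean is `exp(-ρN)`, shows that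
the counts are almost surely unbounded. -/
theorem ae_infinite (hX : IsHomPoissonProcess P X ρ) (hρ : 0 < ρ) :
    ∀ᵐ ω ∂P, (X ω).carrier.Infinite := by
  have hN (N : ℕ) : Measurable fun ω => (X ω).count (Set.Icc (-(N : ℝ)) N) :=
    (PointPattern.measurable_count measurableSet_Icc (Metric.isBounded_Icc _ _)).comp hX.measurable
  have hK (K : ℕ) : P {ω | ∀ N : ℕ, (X ω).count (Set.Icc (-(N : ℝ)) N) ≤ K} = 0 := by
    have hz : ENNReal.ofReal (1 / 2) ^ K * P {ω | ∀ N : ℕ, (X ω).count (Set.Icc (-(N : ℝ)) N) ≤ K}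
        ≤ 0 := by
      have hlim : Filter.Tendsto (fun N : ℕ => ENNReal.ofReal (Real.exp (-(ρ * N))))
          Filter.atTop (nhds 0) := by
        rw [← ENNReal.ofReal_zero]
        refine ENNReal.tendsto_ofReal (Real.tendsto_exp_neg_atTop_nhds_zero.comp ?_)
        exact tendsto_natCast_atTop_atTop.const_mul_atTop hρ
      refine ge_of_tendsto' hlim fun N => ?_
      have h0 : (0 : ℝ) ≤ N := by positivity
      have hexp := hX.lintegral_pow_count hρ.le (A := Set.Icc (-(N : ℝ)) N) measurableSet_Icc
        (Metric.isBounded_Icc _ _) (q := 1 / 2) (by norm_num)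
      rw [Real.volume_real_Icc_of_le (by linarith),
        show ρ * (N - -(N : ℝ)) * (1 / 2 - 1) = -(ρ * N) by ring] at hexp
      rw [← hexp]
      refine le_trans ?_ (mul_meas_ge_le_lintegral ((Measurable.of_discrete
        (f := fun n : ℕ => ENNReal.ofReal (1 / 2) ^ n)).comp (hN N)) (ENNReal.ofReal (1 / 2) ^ K))
      refine mul_le_mul_right (measure_mono fun ω hω => ?_) _
      exact pow_le_pow_right_of_le_one' (ENNReal.ofReal_le_one.2 (by norm_num)) (hω N)
    simpa using hz
  have := ae_all_iff.2 fun K => (ae_iff (p := fun ω => ¬ ∀ N : ℕ,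
    (X ω).count (Set.Icc (-(N : ℝ)) N) ≤ K)).2 (by simpa using hK K)
  filter_upwards [this] with ω hω hfin
  exact hω (X ω).carrier.ncard fun N => Set.ncard_le_ncard Set.inter_subset_left hfin

end IsHomPoissonProcess

/-! ### Independent marks given the positions -/

/-- `b n` are i.i.d. Bernoulli(`p`) marks, independent of the random sequence `ξ`. -/
structure AreIndepMarks {Ω : Type*} [MeasurableSpace Ω] (P : Measure Ω) (ξ : ℕ → Ω → ℝ)
    (b : ℕ → Ω → Bool) (p : ℝ) : Prop where
  measurable_point : ∀ n, Measurable (ξ n)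
  measurable_mark : ∀ n, Measurable (b n)
  measure_mark : ∀ n, P {ω | b n ω = true} = ENNReal.ofReal p
  iIndepFun : iIndepFun b P
  indepFun : IndepFun (fun ω n => ξ n ω) (fun ω n => b n ω) P

namespace AreIndepMarks

variable {Ω : Type*} [MeasurableSpace Ω] {P : Measure Ω} [IsProbabilityMeasure P]
  {ξ : ℕ → Ω → ℝ} {b : ℕ → Ω → Bool} {p : ℝ}

theorem measure_not_mark (h : AreIndepMarks P ξ b p) (hp : 0 ≤ p) (n : ℕ) :
    P {ω | b n ω = false} = ENNReal.ofReal (1 - p) := by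
  have hm : MeasurableSet {ω | b n ω = true} := h.measurable_mark n (measurableSet_singleton true)
  have : {ω | b n ω = false} = {ω | b n ω = true}ᶜ := by ext; simp
  rw [this, prob_compl_eq_one_sub hm, h.measure_mark, ENNReal.ofReal_sub _ hp, ENNReal.ofReal_one]

theorem measure_mark_inter (h : AreIndepMarks P ξ b p) (hp : 0 ≤ p) {n : ℕ} {F : Finset ℕ}
    (hn : n ∉ F) :
    P {ω | b n ω = true ∧ ∀ k ∈ F, b k ω = false} =
      ENNReal.ofReal p * ENNReal.ofReal (1 - p) ^ F.card := by
  have hI := h.iIndepFun.measure_inter_preimage_eq_mul (insert n F)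
    (sets := fun k => if k = n then {true} else {false}) (fun i _ => MeasurableSet.of_discrete)
  rw [Finset.prod_insert hn] at hI
  have hF : ∏ k ∈ F, P (b k ⁻¹' if k = n then {true} else {false}) =
      ENNReal.ofReal (1 - p) ^ F.card := by
    refine Finset.prod_eq_pow_card fun k hk => ?_
    rw [if_neg (fun h : k = n => hn (h ▸ hk))]
    exact h.measure_not_mark hp k
  rw [hF, if_pos rfl] at hI
  rw [← h.measure_mark n]
  refine Eq.trans (congrArg P ?_) hI
  ext ω
  simp only [Finset.mem_insert, Set.mem_iInter, Set.mem_preimage, forall_eq_or_imp, if_true]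
  refine and_congr Iff.rfl (forall₂_congr fun k hk => ?_)
  simp [show k ≠ n from fun h => hn (h ▸ hk)]

/-- Since the marks are independent of the positions, Fubini allows the positions to be frozen; `C`
is then a fixed finite set of indices avoiding `n`, and its marks and that of `n` are independent.
-/
theorem measure_mark_and_not (h : AreIndepMarks P ξ b p) (hp : 0 ≤ p) {n : ℕ}
    {W : Set (ℕ → ℝ)} (hW : MeasurableSet W) {C : (ℕ → ℝ) → Set ℕ}
    (hC : ∀ k, MeasurableSet {x | k ∈ C x}) (hn : ∀ x, n ∉ C x)
    (hfin : ∀ᵐ ω ∂P, (fun k => ξ k ω) ∈ W → (C fun k => ξ k ω).Finite) :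
    P {ω | b n ω = true ∧ (fun k => ξ k ω) ∈ W ∧ ∀ k ∈ C fun k => ξ k ω, b k ω = false} =
      ∫⁻ ω, (ENNReal.ofReal p * ENNReal.ofReal (1 - p) ^ (C fun k => ξ k ω).ncard) *
        W.indicator 1 (fun k => ξ k ω) ∂P := by
  have hξ : Measurable fun ω n => ξ n ω := measurable_pi_lambda _ h.measurable_point
  have hb : Measurable fun ω n => b n ω := measurable_pi_lambda _ h.measurable_mark
  -- The random index set is handled by a countable intersection over all `k`, which makes the event
  -- jointly measurable in positions and marks.
  let S : Set ((ℕ → ℝ) × (ℕ → Bool)) :=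
    {z | z.2 n = true} ∩ ({z | z.1 ∈ W} ∩ ⋂ k, ({z | k ∈ C z.1}ᶜ ∪ {z | z.2 k = false}))
  have hS : MeasurableSet S := by
    refine MeasurableSet.inter ?_ (MeasurableSet.inter (measurable_fst hW)
      (MeasurableSet.iInter fun k => MeasurableSet.union ?_ ?_))
    · exact ((measurable_pi_apply (X := fun _ : ℕ => Bool) n).comp measurable_snd) (measurableSet_singleton true)
    · exact (measurable_fst (hC k)).compl
    · exact ((measurable_pi_apply (X := fun _ : ℕ => Bool) k).comp measurable_snd) (measurableSet_singleton false)
  have hSmem (x : ℕ → ℝ) (β : ℕ → Bool) :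
      (x, β) ∈ S ↔ β n = true ∧ x ∈ W ∧ ∀ k ∈ C x, β k = false := by
    simp only [S, Set.mem_inter_iff, Set.mem_iInter, Set.mem_union, Set.mem_compl_iff]
    refine and_congr Iff.rfl (and_congr Iff.rfl (forall_congr' fun k => ?_))
    exact imp_iff_not_or.symm
  have hmap := h.indepFun.map_prod_eq_prod_map_map hξ.aemeasurable hb.aemeasurable
  have hpre : {ω | b n ω = true ∧ (fun k => ξ k ω) ∈ W ∧ ∀ k ∈ C fun k => ξ k ω, b k ω = false} =
      (fun ω => ((fun n => ξ n ω), fun n => b n ω)) ⁻¹' S := by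
    ext ω; exact (hSmem (fun k => ξ k ω) (fun k => b k ω)).symm
  rw [hpre, ← Measure.map_apply (hξ.prodMk hb) hS, hmap, Measure.prod_apply hS,
    lintegral_map (measurable_measure_prodMk_left hS) hξ]
  refine lintegral_congr_ae ?_
  filter_upwards [hfin] with ω hω
  rw [Measure.map_apply hb (hS.preimage measurable_prodMk_left)]
  by_cases hx : (fun k => ξ k ω) ∈ W
  · rw [Set.indicator_of_mem hx, Pi.one_apply, mul_one, Set.ncard_eq_toFinset_card _ (hω hx),
      ← h.measure_mark_inter hp (n := n) (F := (hω hx).toFinset) (by simpa using hn _)]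
    congr 1
    ext ω'
    rw [Set.mem_preimage, Set.mem_preimage, hSmem]
    simp [hx]
  · rw [Set.indicator_of_notMem hx, mul_zero]
    convert! measure_empty (μ := P)
    ext ω'
    rw [Set.mem_preimage, Set.mem_preimage, hSmem]
    simp [hx]

end AreIndepMarks

/-! ### Counts of an enumerated pattern -/

namespace PointPattern

theorem finite_setOf_mem {s : PointPattern} {x : ℕ → ℝ} (hx : x.Injective)
    (hs : s.carrier = Set.range x) {W : Set ℝ} (hW : Bornology.IsBounded W) :
    {k | x k ∈ W}.Finite := by
  refine Set.Finite.of_finite_image ((s.locallyFinite W hW).subset ?_) hx.injOn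
  rintro _ ⟨k, hk, rfl⟩
  exact ⟨hs ▸ ⟨k, rfl⟩, hk⟩

theorem count_eq_ncard {s : PointPattern} {x : ℕ → ℝ} (hx : x.Injective)
    (hs : s.carrier = Set.range x) (W : Set ℝ) : s.count W = {k | x k ∈ W}.ncard := by
  rw [count, ← Set.ncard_image_of_injective _ hx]
  congr 1
  ext y
  rw [hs]
  constructor
  · rintro ⟨⟨k, rfl⟩, hk⟩; exact ⟨k, hk, rfl⟩
  · rintro ⟨k, hk, rfl⟩; exact ⟨⟨k, rfl⟩, hk⟩

theorem count_eq_tsum_indicator {s : PointPattern} {x : ℕ → ℝ} (hx : x.Injective)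
    (hs : s.carrier = Set.range x) {W : Set ℝ} (hW : Bornology.IsBounded W) :
    (s.count W : ℝ≥0∞) = ∑' n, W.indicator 1 (x n) := by
  rw [count_eq_tsum hx (N := Set.univ) (by rw [hs, Set.image_univ]) hW]
  refine tsum_congr fun n => ?_
  by_cases h : x n ∈ W
  · rw [Set.indicator_of_mem h, Set.indicator_of_mem (Set.mem_ofPred_eq ▸ ⟨Set.mem_univ n, h⟩)]
    rfl
  · rw [Set.indicator_of_notMem h, Set.indicator_of_notMem (fun h' => h h'.2)]

end PointPattern

/-! ### Intensity of retained points with prescribed gaps -/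

theorem volume_real_Ioc_union_Ioc {a b c d : ℝ} (h : b ≤ c) :
    volume.real (Set.Ioc a b ∪ Set.Ioc c d) = max (b - a) 0 + max (d - c) 0 := by
  rw [measureReal_union (Set.Ioc_disjoint_Ioc_of_le h) measurableSet_Ioc
    (by simp) (by simp), Real.volume_real_Ioc, Real.volume_real_Ioc]

/-- The points strictly between `x n - s` and `x n + t`, other than `x n`. -/
def neighbours (x : ℕ → ℝ) (s t : ℝ) (n : ℕ) : Set ℕ :=
  {k | x k ∈ Set.Ioo (x n - s) (x n) ∪ Set.Ioo (x n) (x n + t)}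

/-- The index set on the right depends on the positions alone, which is the form needed for
conditioning on them. -/
theorem gaps_iff_neighbours {x : ℕ → ℝ} {b : ℕ → Bool} {s t : ℝ} {n : ℕ} :
    (ENNReal.ofReal s ≤ leftGap x b n ∧ ENNReal.ofReal t ≤ rightGap x b n) ↔
      ∀ k ∈ neighbours x s t n, b k = false := by
  rw [ofReal_le_leftGap_iff, ofReal_le_rightGap_iff]
  constructor
  · rintro ⟨hl, hr⟩ k hk
    by_contra hb
    rw [Bool.not_eq_false] at hb
    rcases hk with ⟨h1, h2⟩ | ⟨h1, h2⟩
    · linarith [hl k hb h2]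
    · linarith [hr k hb h1]
  · refine fun h => ⟨fun k hb hk => ?_, fun k hb hk => ?_⟩
    · by_contra hlt
      simpa [hb] using h k (Or.inl ⟨not_le.1 hlt, hk⟩)
    · by_contra hlt
      simpa [hb] using h k (Or.inr ⟨hk, not_le.1 hlt⟩)

/-- The intensity measure of the points of `ξ` that are marked by `b` and whose distances to the
marked points next to them on the left and on the right are at least `s` and `t`. -/
noncomputable def gapMeasure {Ω : Type*} [MeasurableSpace Ω] (P : Measure Ω) (ξ : ℕ → Ω → ℝ)
    (b : ℕ → Ω → Bool) (s t : ℝ) : Measure ℝ :=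
  Measure.sum fun n => (P.restrict {ω | b n ω = true ∧
    ENNReal.ofReal s ≤ leftGap (fun k => ξ k ω) (fun k => b k ω) n ∧
    ENNReal.ofReal t ≤ rightGap (fun k => ξ k ω) (fun k => b k ω) n}).map (ξ n)

theorem measurable_point_gaps {Ω : Type*} [MeasurableSpace Ω] {P : Measure Ω} {p : ℝ}
    {ξ : ℕ → Ω → ℝ} {b : ℕ → Ω → Bool} (hm : AreIndepMarks P ξ b p) (n : ℕ) :
    Measurable fun ω =>
    (ξ n ω, (leftGap (fun k => ξ k ω) (fun k => b k ω) n).toReal,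
      (rightGap (fun k => ξ k ω) (fun k => b k ω) n).toReal) :=
  (hm.measurable_point n).prodMk
    ((measurable_leftGap hm.measurable_point hm.measurable_mark n).ennreal_toReal.prodMk
    (measurable_rightGap hm.measurable_point hm.measurable_mark n).ennreal_toReal)

theorem measurable_ite_point_gaps {Ω : Type*} [MeasurableSpace Ω] {P : Measure Ω} {p : ℝ}
    {ξ : ℕ → Ω → ℝ} {b : ℕ → Ω → Bool} (hm : AreIndepMarks P ξ b p) {h : ℝ × ℝ × ℝ → ℝ≥0∞}
    (hh : Measurable h) (n : ℕ) : Measurable fun ω => if b n ω = true then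
      h (ξ n ω, (leftGap (fun k => ξ k ω) (fun k => b k ω) n).toReal,
        (rightGap (fun k => ξ k ω) (fun k => b k ω) n).toReal) else 0 :=
  Measurable.ite (hm.measurable_mark n (measurableSet_singleton true))
    (hh.comp (measurable_point_gaps hm n)) measurable_const

section

variable {Ω : Type*} [MeasurableSpace Ω] {P : Measure Ω} [IsProbabilityMeasure P]
  {X : Ω → PointPattern} {ρ p : ℝ} {ξ : ℕ → Ω → ℝ} {b : ℕ → Ω → Bool}

theorem gapMeasure_apply (hm : AreIndepMarks P ξ b p) (hp : 0 ≤ p)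
    (hξ : ∀ᵐ ω ∂P, (Function.Injective fun n => ξ n ω) ∧
      (X ω).carrier = Set.range fun n => ξ n ω) (s t : ℝ) {W : Set ℝ} (hW : MeasurableSet W) :
    gapMeasure P ξ b s t W = ∑' n, ∫⁻ ω, (ENNReal.ofReal p * ENNReal.ofReal (1 - p) ^
      (neighbours (fun k => ξ k ω) s t n).ncard) * W.indicator 1 (ξ n ω) ∂P := by
  rw [gapMeasure, Measure.sum_apply _ hW]
  refine tsum_congr fun n => ?_
  rw [Measure.map_apply (hm.measurable_point n) hW,
    Measure.restrict_apply (hm.measurable_point n hW)]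
  have h := hm.measure_mark_and_not hp (n := n) (W := {x | x n ∈ W})
    (hW.preimage (measurable_pi_apply n)) (C := fun x => neighbours x s t n) ?_ ?_ ?_
  · refine Eq.trans (congrArg P ?_) h
    ext ω
    rw [Set.mem_inter_iff, Set.mem_ofPred_eq, gaps_iff_neighbours]
    simp only [Set.mem_preimage, Set.mem_ofPred_eq]
    tauto
  · intro k
    have h1 : Measurable fun x : ℕ → ℝ => x n := measurable_pi_apply n
    have h2 : Measurable fun x : ℕ → ℝ => x k := measurable_pi_apply k
    exact ((measurableSet_lt (h1.sub_const s) h2).inter (measurableSet_lt h2 h1)).union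
      ((measurableSet_lt h1 h2).inter (measurableSet_lt h2 (h1.add_const t)))
  · rintro x (h | h)
    · exact lt_irrefl _ h.2
    · exact lt_irrefl _ h.1
  · filter_upwards [hξ] with ω hω _
    exact PointPattern.finite_setOf_mem hω.1 hω.2
      ((Metric.isBounded_Ioo _ _).union (Metric.isBounded_Ioo _ _))

/-- For every point of `I` the set `U` lies within its neighbourhood, so `(1-p)^count U` bounds the
conditional probability that all neighbours are deleted. As `U` is disjoint from `I`, the
expectation factors. -/
theorem gapMeasure_Ioc_le (hX : IsHomPoissonProcess P X ρ) (hρ : 0 ≤ ρ)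
    (hm : AreIndepMarks P ξ b p) (hp : 0 ≤ p) (hp1 : p ≤ 1)
    (hξ : ∀ᵐ ω ∂P, (Function.Injective fun n => ξ n ω) ∧
      (X ω).carrier = Set.range fun n => ξ n ω) (s t c δ : ℝ) (hδ : 0 ≤ δ) :
    gapMeasure P ξ b s t (Set.Ioc c (c + δ)) ≤ ENNReal.ofReal
      (p * ρ * Real.exp (-(p * ρ * (s + t))) * δ * Real.exp (2 * (p * ρ) * δ)) := by
  set I := Set.Ioc c (c + δ) with hI
  set U := Set.Ioc (c + δ - s) c ∪ Set.Ioc (c + δ) (c + t) with hU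
  have hIm : MeasurableSet I := measurableSet_Ioc
  have hIb : Bornology.IsBounded I := Metric.isBounded_Ioc _ _
  have hUm : MeasurableSet U := measurableSet_Ioc.union measurableSet_Ioc
  have hUb : Bornology.IsBounded U := (Metric.isBounded_Ioc _ _).union (Metric.isBounded_Ioc _ _)
  have hd : Disjoint I U := Set.disjoint_union_right.2
    ⟨(Set.Ioc_disjoint_Ioc_of_le le_rfl).symm, Set.Ioc_disjoint_Ioc_of_le le_rfl⟩
  have hz : ENNReal.ofReal (1 - p) ≤ 1 := ENNReal.ofReal_le_one.2 (by linarith)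
  have hmono : gapMeasure P ξ b s t I ≤ ∑' n, ∫⁻ ω, ENNReal.ofReal p *
      (ENNReal.ofReal (1 - p) ^ (X ω).count U * I.indicator 1 (ξ n ω)) ∂P := by
    rw [gapMeasure_apply hm hp hξ s t hIm]
    refine ENNReal.tsum_le_tsum fun n => lintegral_mono_ae ?_
    filter_upwards [hξ] with ω hω
    by_cases hn : ξ n ω ∈ I
    · rw [mul_assoc]
      refine mul_le_mul_right (mul_le_mul_left (pow_le_pow_right_of_le_one' hz ?_) _) _
      rw [PointPattern.count_eq_ncard hω.1 hω.2]
      refine Set.ncard_le_ncard ?_ (PointPattern.finite_setOf_mem hω.1 hω.2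
        ((Metric.isBounded_Ioo _ _).union (Metric.isBounded_Ioo _ _)))
      rintro k (hk | hk)
      · exact Or.inl ⟨by linarith [hk.1, hn.2], hk.2.trans_lt hn.1⟩
      · exact Or.inr ⟨hn.2.trans_lt hk.1, by linarith [hk.2, hn.1]⟩
    · rw [Set.indicator_of_notMem hn]; simp
  refine hmono.trans ?_
  have hcI := (PointPattern.measurable_count hIm hIb).comp hX.measurable
  have hcU := (PointPattern.measurable_count hUm hUb).comp hX.measurable
  have hzU : Measurable fun ω => ENNReal.ofReal (1 - p) ^ (X ω).count U :=
    (Measurable.of_discrete (f := fun n : ℕ => ENNReal.ofReal (1 - p) ^ n)).comp hcU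
  have hIξ (n : ℕ) : Measurable fun ω => I.indicator (1 : ℝ → ℝ≥0∞) (ξ n ω) :=
    (measurable_one.indicator hIm).comp (hm.measurable_point n)
  rw [← lintegral_tsum fun n => by fun_prop]
  -- The trivial factor with base 1 puts the integrand in the form of
  -- `lintegral_count_mul_pow_mul_pow`.
  have hsum : ∫⁻ ω, ∑' n, ENNReal.ofReal p *
      (ENNReal.ofReal (1 - p) ^ (X ω).count U * I.indicator 1 (ξ n ω)) ∂P =
      ∫⁻ ω, ENNReal.ofReal p * (((X ω).count I : ℝ≥0∞) * ENNReal.ofReal 1 ^ ((X ω).count I - 1) *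
        ENNReal.ofReal (1 - p) ^ (X ω).count U) ∂P := by
    refine lintegral_congr_ae ?_
    filter_upwards [hξ] with ω hω
    rw [ENNReal.tsum_mul_left, ENNReal.tsum_mul_left,
      ← PointPattern.count_eq_tsum_indicator hω.1 hω.2 hIb]
    simp only [ENNReal.ofReal_one, one_pow, mul_one]
    rw [mul_comm (_ ^ _)]
  rw [hsum, lintegral_const_mul' _ _ ENNReal.ofReal_ne_top,
    hX.lintegral_count_mul_pow_mul_pow hρ hIm hIb hUm hUb hd zero_le_one (by linarith),
    ← ENNReal.ofReal_mul hp, hI, Real.volume_real_Ioc_of_le (by linarith), hU,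
    volume_real_Ioc_union_Ioc (by linarith)]
  refine ENNReal.ofReal_le_ofReal ?_
  have e1 : p * (ρ * (c + δ - c) * Real.exp (ρ * (c + δ - c) * (1 - 1)) *
      Real.exp (ρ * (max (c - (c + δ - s)) 0 + max (c + t - (c + δ)) 0) * (1 - p - 1))) =
      p * ρ * δ *
      Real.exp (-(p * ρ * (max (c - (c + δ - s)) 0 + max (c + t - (c + δ)) 0))) := by
    rw [sub_self, mul_zero, Real.exp_zero, add_sub_cancel_left]
    ring_nf
  have e2 : p * ρ * Real.exp (-(p * ρ * (s + t))) * δ * Real.exp (2 * (p * ρ) * δ) =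
      p * ρ * δ * Real.exp (-(p * ρ * (s + t - 2 * δ))) := by
    rw [show -(p * ρ * (s + t - 2 * δ)) = -(p * ρ * (s + t)) + 2 * (p * ρ) * δ by ring,
      Real.exp_add]
    ring
  rw [e1, e2]
  refine mul_le_mul_of_nonneg_left (Real.exp_le_exp.2 (neg_le_neg
    (mul_le_mul_of_nonneg_left ?_ (by positivity)))) (by positivity)
  -- The length of `U` is at least `s + t - 2δ`, which is the source of the constant 2.
  linarith [le_max_left (c - (c + δ - s)) 0, le_max_left (c + t - (c + δ)) 0]

/-- Now `U` together with the other points of `I` covers all neighbours of any point of `I`. Leaving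
out the point itself gives the exponent `count I - 1`. -/
theorem le_gapMeasure_Ioc (hX : IsHomPoissonProcess P X ρ) (hρ : 0 ≤ ρ)
    (hm : AreIndepMarks P ξ b p) (hp : 0 ≤ p) (hp1 : p ≤ 1)
    (hξ : ∀ᵐ ω ∂P, (Function.Injective fun n => ξ n ω) ∧
      (X ω).carrier = Set.range fun n => ξ n ω) {s t : ℝ} (hs : 0 ≤ s) (ht : 0 ≤ t) (c δ : ℝ)
    (hδ : 0 ≤ δ) :
    ENNReal.ofReal
      (p * ρ * Real.exp (-(p * ρ * (s + t))) * δ * Real.exp (-(2 * (p * ρ) * δ))) ≤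
    gapMeasure P ξ b s t (Set.Ioc c (c + δ)) := by
  set I := Set.Ioc c (c + δ) with hI
  set U := Set.Ioc (c - s) c ∪ Set.Ioc (c + δ) (c + δ + t) with hU
  have hIm : MeasurableSet I := measurableSet_Ioc
  have hIb : Bornology.IsBounded I := Metric.isBounded_Ioc _ _
  have hUm : MeasurableSet U := measurableSet_Ioc.union measurableSet_Ioc
  have hUb : Bornology.IsBounded U := (Metric.isBounded_Ioc _ _).union (Metric.isBounded_Ioc _ _)
  have hd : Disjoint I U := Set.disjoint_union_right.2
    ⟨(Set.Ioc_disjoint_Ioc_of_le le_rfl).symm, Set.Ioc_disjoint_Ioc_of_le le_rfl⟩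
  have hz : ENNReal.ofReal (1 - p) ≤ 1 := ENNReal.ofReal_le_one.2 (by linarith)
  have hmono : ∑' n, ∫⁻ ω, ENNReal.ofReal p * (ENNReal.ofReal (1 - p) ^
      ((X ω).count I - 1 + (X ω).count U) * I.indicator 1 (ξ n ω)) ∂P ≤
      gapMeasure P ξ b s t I := by
    rw [gapMeasure_apply hm hp hξ s t hIm]
    refine ENNReal.tsum_le_tsum fun n => lintegral_mono_ae ?_
    filter_upwards [hξ] with ω hω
    by_cases hn : ξ n ω ∈ I
    · rw [mul_assoc]
      refine mul_le_mul_right (mul_le_mul_left (pow_le_pow_right_of_le_one' hz ?_) _) _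
      have hfI := PointPattern.finite_setOf_mem hω.1 hω.2 hIb
      have hfU := PointPattern.finite_setOf_mem hω.1 hω.2 hUb
      rw [PointPattern.count_eq_ncard hω.1 hω.2, PointPattern.count_eq_ncard hω.1 hω.2,
        ← Set.ncard_sdiff_singleton_of_mem (show n ∈ {k | ξ k ω ∈ I} from hn)]
      refine (Set.ncard_le_ncard ?_ (hfI.sdiff.union hfU)).trans (Set.ncard_union_le _ _)
      rintro k (hk | hk)
      · rcases le_or_gt (ξ k ω) c with h | h
        · exact Or.inr (Or.inl ⟨by linarith [hk.1, hn.1], h⟩)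
        · refine Or.inl ⟨⟨h, hk.2.le.trans hn.2⟩, fun he => ?_⟩
          have : k = n := he
          exact lt_irrefl _ (this ▸ hk.2)
      · rcases le_or_gt (ξ k ω) (c + δ) with h | h
        · refine Or.inl ⟨⟨hn.1.trans hk.1, h⟩, fun he => ?_⟩
          have : k = n := he
          exact lt_irrefl _ (this ▸ hk.1)
        · exact Or.inr (Or.inr ⟨h, by linarith [hk.2, hn.2]⟩)
    · rw [Set.indicator_of_notMem hn]; simp
  refine le_trans ?_ hmono
  have hcI := (PointPattern.measurable_count hIm hIb).comp hX.measurable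
  have hcU := (PointPattern.measurable_count hUm hUb).comp hX.measurable
  have hzU : Measurable fun ω => ENNReal.ofReal (1 - p) ^ ((X ω).count I - 1 + (X ω).count U) :=
    (Measurable.of_discrete (f := fun z : ℕ × ℕ => ENNReal.ofReal (1 - p) ^ (z.1 - 1 + z.2))).comp
      (hcI.prodMk hcU)
  have hIξ (n : ℕ) : Measurable fun ω => I.indicator (1 : ℝ → ℝ≥0∞) (ξ n ω) :=
    (measurable_one.indicator hIm).comp (hm.measurable_point n)
  rw [← lintegral_tsum fun n => by fun_prop]
  have hsum : ∫⁻ ω, ∑' n, ENNReal.ofReal p * (ENNReal.ofReal (1 - p) ^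
      ((X ω).count I - 1 + (X ω).count U) * I.indicator 1 (ξ n ω)) ∂P =
      ∫⁻ ω, ENNReal.ofReal p * (((X ω).count I : ℝ≥0∞) *
        ENNReal.ofReal (1 - p) ^ ((X ω).count I - 1) *
        ENNReal.ofReal (1 - p) ^ (X ω).count U) ∂P := by
    refine lintegral_congr_ae ?_
    filter_upwards [hξ] with ω hω
    rw [ENNReal.tsum_mul_left, ENNReal.tsum_mul_left,
      ← PointPattern.count_eq_tsum_indicator hω.1 hω.2 hIb, pow_add]
    ring
  rw [hsum, lintegral_const_mul' _ _ ENNReal.ofReal_ne_top,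
    hX.lintegral_count_mul_pow_mul_pow hρ hIm hIb hUm hUb hd (by linarith) (by linarith),
    ← ENNReal.ofReal_mul hp, hI, Real.volume_real_Ioc_of_le (by linarith), hU,
    volume_real_Ioc_union_Ioc (by linarith), max_eq_left (by linarith), max_eq_left (by linarith)]
  refine ENNReal.ofReal_le_ofReal ?_
  have e1 : p * (ρ * (c + δ - c) * Real.exp (ρ * (c + δ - c) * (1 - p - 1)) *
      Real.exp (ρ * (c - (c - s) + (c + δ + t - (c + δ))) * (1 - p - 1))) =
      p * ρ * Real.exp (-(p * ρ * (s + t))) * δ * Real.exp (-(p * ρ * δ)) := by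
    rw [add_sub_cancel_left, show ρ * δ * (1 - p - 1) = -(p * ρ * δ) by ring,
      show ρ * (c - (c - s) + (c + δ + t - (c + δ))) * (1 - p - 1) = -(p * ρ * (s + t)) by ring]
    ring
  rw [e1]
  -- The loss is only `exp(-pρδ)`; it is weakened to share the rate `2pρ` of the upper bound.
  refine mul_le_mul_of_nonneg_left (Real.exp_le_exp.2 (neg_le_neg ?_)) (by positivity)
  have : 0 ≤ p * ρ * δ := by positivity
  linarith

theorem gapMeasure_Ioc (hX : IsHomPoissonProcess P X ρ) (hρ : 0 ≤ ρ)
    (hm : AreIndepMarks P ξ b p) (hp : 0 ≤ p) (hp1 : p ≤ 1)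
    (hξ : ∀ᵐ ω ∂P, (Function.Injective fun n => ξ n ω) ∧
      (X ω).carrier = Set.range fun n => ξ n ω) {s t : ℝ} (hs : 0 ≤ s) (ht : 0 ≤ t) (c d : ℝ) :
    gapMeasure P ξ b s t (Set.Ioc c d) =
      ENNReal.ofReal (p * ρ * Real.exp (-(p * ρ * (s + t))) * (d - c)) :=
  measure_Ioc_eq_of_local_bounds (by positivity) (le_gapMeasure_Ioc hX hρ hm hp hp1 hξ hs ht)
    (gapMeasure_Ioc_le hX hρ hm hp hp1 hξ s t) c d

/-- In a bounded window the intensity of retained points with a gap of at least `N` decays like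
`exp(-pρN)`. Infinite gaps must be excluded because `toReal` would turn them into 0. -/
theorem ae_gaps_ne_top (hX : IsHomPoissonProcess P X ρ) (hρ : 0 < ρ)
    (hm : AreIndepMarks P ξ b p) (hp : 0 < p) (hp1 : p ≤ 1)
    (hξ : ∀ᵐ ω ∂P, (Function.Injective fun n => ξ n ω) ∧
      (X ω).carrier = Set.range fun n => ξ n ω) :
    ∀ᵐ ω ∂P, ∀ n, b n ω = true → leftGap (fun k => ξ k ω) (fun k => b k ω) n ≠ ∞ ∧
      rightGap (fun k => ξ k ω) (fun k => b k ω) n ≠ ∞ := by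
  have hle (s t : ℝ) (n : ℕ) (W : Set ℝ) (hW : MeasurableSet W) :
      P {ω | (b n ω = true ∧ ENNReal.ofReal s ≤ leftGap (fun k => ξ k ω) (fun k => b k ω) n ∧
        ENNReal.ofReal t ≤ rightGap (fun k => ξ k ω) (fun k => b k ω) n) ∧ ξ n ω ∈ W} ≤
      gapMeasure P ξ b s t W := by
    rw [gapMeasure, Measure.sum_apply _ hW]
    refine le_trans (le_of_eq ?_) (ENNReal.le_tsum n)
    rw [Measure.map_apply (hm.measurable_point n) hW,
      Measure.restrict_apply (hm.measurable_point n hW)]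
    congr 1
    ext ω
    exact and_comm
  have hlim (K : ℝ) : Filter.Tendsto
      (fun N : ℕ => ENNReal.ofReal (p * ρ * Real.exp (-(p * ρ * N)) * K)) Filter.atTop (nhds 0) := by
    have h1 : Filter.Tendsto (fun N : ℕ => p * ρ * (N : ℝ)) Filter.atTop Filter.atTop :=
      tendsto_natCast_atTop_atTop.const_mul_atTop (by positivity)
    have h2 := ((Real.tendsto_exp_neg_atTop_nhds_zero.comp h1).const_mul (p * ρ)).mul_const K
    rw [mul_zero, zero_mul] at h2
    simpa using ENNReal.tendsto_ofReal h2
  have hnull (n m : ℕ) :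
      (∀ᵐ ω ∂P, ¬ (b n ω = true ∧ leftGap (fun k => ξ k ω) (fun k => b k ω) n = ∞ ∧
        ξ n ω ∈ Set.Ioc (-(m : ℝ)) m)) ∧
      ∀ᵐ ω ∂P, ¬ (b n ω = true ∧ rightGap (fun k => ξ k ω) (fun k => b k ω) n = ∞ ∧
        ξ n ω ∈ Set.Ioc (-(m : ℝ)) m) := by
    simp only [ae_iff, not_not]
    refine ⟨le_antisymm (ge_of_tendsto' (hlim (m - -m)) fun N => ?_) zero_le,
      le_antisymm (ge_of_tendsto' (hlim (m - -m)) fun N => ?_) zero_le⟩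
    · have h := hle N 0 n (Set.Ioc (-(m : ℝ)) m) measurableSet_Ioc
      rw [gapMeasure_Ioc hX hρ.le hm hp.le hp1 hξ (by positivity) le_rfl, add_zero] at h
      refine le_trans (measure_mono ?_) h
      rintro ω ⟨h1, h2, h3⟩
      exact ⟨⟨h1, by rw [h2]; exact le_top, by simp⟩, h3⟩
    · have h := hle 0 N n (Set.Ioc (-(m : ℝ)) m) measurableSet_Ioc
      rw [gapMeasure_Ioc hX hρ.le hm hp.le hp1 hξ le_rfl (by positivity), zero_add] at h
      refine le_trans (measure_mono ?_) h
      rintro ω ⟨h1, h2, h3⟩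
      exact ⟨⟨h1, by simp, by rw [h2]; exact le_top⟩, h3⟩
  have h1 := ae_all_iff.2 fun n => ae_all_iff.2 fun m => (hnull n m).1
  have h2 := ae_all_iff.2 fun n => ae_all_iff.2 fun m => (hnull n m).2
  filter_upwards [h1, h2] with ω h1 h2 n hn
  obtain ⟨m, hmx⟩ := exists_nat_gt |ξ n ω|
  have hmem : ξ n ω ∈ Set.Ioc (-(m : ℝ)) m := ⟨by linarith [neg_abs_le (ξ n ω)],
    by linarith [le_abs_self (ξ n ω)]⟩
  exact ⟨fun h => h1 n m ⟨hn, h, hmem⟩, fun h => h2 n m ⟨hn, h, hmem⟩⟩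

/-! ### Joint intensity of points and gaps -/

theorem sum_map_point_gaps (hX : IsHomPoissonProcess P X ρ) (hρ : 0 < ρ)
    (hm : AreIndepMarks P ξ b p) (hp : 0 < p) (hp1 : p ≤ 1)
    (hξ : ∀ᵐ ω ∂P, (Function.Injective fun n => ξ n ω) ∧
      (X ω).carrier = Set.range fun n => ξ n ω) :
    (Measure.sum fun n => (P.restrict {ω | b n ω = true}).map fun ω =>
      (ξ n ω, (leftGap (fun k => ξ k ω) (fun k => b k ω) n).toReal,
        (rightGap (fun k => ξ k ω) (fun k => b k ω) n).toReal)) =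
      (ENNReal.ofReal (p * ρ) • volume).prod
        ((expMeasure (p * ρ)).prod (expMeasure (p * ρ))) := by
  refine eq_prod_expMeasure_of_rectangles (by positivity) fun c d s t => ?_
  -- Gaps are nonnegative, so a negative threshold acts like 0.
  rw [← gapMeasure_Ioc hX hρ.le hm hp.le hp1 hξ (le_max_right s 0) (le_max_right t 0), gapMeasure,
    Measure.sum_apply _ measurableSet_Ioc,
    Measure.sum_apply _ (measurableSet_Ioc.prod (measurableSet_Ici.prod measurableSet_Ici))]
  refine tsum_congr fun n => ?_
  have hmeas := measurable_point_gaps hm n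
  have hrect := measurableSet_Ioc (a := c) (b := d) |>.prod
    ((measurableSet_Ici (a := s)).prod (measurableSet_Ici (a := t)))
  rw [Measure.map_apply (hm.measurable_point n) measurableSet_Ioc,
    Measure.restrict_apply (hm.measurable_point n measurableSet_Ioc),
    Measure.map_apply hmeas hrect, Measure.restrict_apply (hmeas hrect)]
  refine measure_congr ?_
  filter_upwards [ae_gaps_ne_top hX hρ hm hp hp1 hξ] with ω hω
  refine propext ⟨?_, ?_⟩
  · rintro ⟨⟨h1, h2, h3⟩, hb⟩
    refine ⟨h1, hb, ?_, ?_⟩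
    · exact (ENNReal.ofReal_le_iff_le_toReal (hω n hb).1).2 (max_le h2 ENNReal.toReal_nonneg)
    · exact (ENNReal.ofReal_le_iff_le_toReal (hω n hb).2).2 (max_le h3 ENNReal.toReal_nonneg)
  · rintro ⟨h1, hb, h2, h3⟩
    refine ⟨⟨h1, ?_, ?_⟩, hb⟩
    · exact (le_max_left _ _).trans ((ENNReal.ofReal_le_iff_le_toReal (hω n hb).1).1 h2)
    · exact (le_max_left _ _).trans ((ENNReal.ofReal_le_iff_le_toReal (hω n hb).2).1 h3)

/-- This is Campbell's formula for the intensity measure above. The position is integrated first,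
with the gaps fixed, as each application requires. -/
theorem lintegral_tsum_point_gaps (hX : IsHomPoissonProcess P X ρ) (hρ : 0 < ρ)
    (hm : AreIndepMarks P ξ b p) (hp : 0 < p) (hp1 : p ≤ 1)
    (hξ : ∀ᵐ ω ∂P, (Function.Injective fun n => ξ n ω) ∧
      (X ω).carrier = Set.range fun n => ξ n ω)
    {h : ℝ × ℝ × ℝ → ℝ≥0∞} (hh : Measurable h) :
    ∫⁻ ω, ∑' n, (if b n ω = true then
      h (ξ n ω, (leftGap (fun k => ξ k ω) (fun k => b k ω) n).toReal,
        (rightGap (fun k => ξ k ω) (fun k => b k ω) n).toReal) else 0) ∂P =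
      ENNReal.ofReal (p * ρ) * ∫⁻ z, ∫⁻ x, h (x, z) ∂volume
        ∂((expMeasure (p * ρ)).prod (expMeasure (p * ρ))) := by
  have := isProbabilityMeasure_expMeasure (r := p * ρ) (by positivity)
  have hbm (n : ℕ) : MeasurableSet {ω | b n ω = true} :=
    hm.measurable_mark n (measurableSet_singleton true)
  rw [lintegral_tsum fun n => (measurable_ite_point_gaps hm hh n).aemeasurable]
  have hsum := congrArg (fun M => ∫⁻ z, h z ∂M) (sum_map_point_gaps hX hρ hm hp hp1 hξ)
  beta_reduce at hsum
  rw [lintegral_sum_measure, lintegral_prod_symm _ hh.aemeasurable] at hsum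
  simp only [lintegral_smul_measure, smul_eq_mul] at hsum
  rw [lintegral_const_mul' _ _ ENNReal.ofReal_ne_top] at hsum
  rw [← hsum]
  refine tsum_congr fun n => ?_
  rw [lintegral_map hh (measurable_point_gaps hm n), ← lintegral_indicator (hbm n)]
  refine lintegral_congr fun ω => ?_
  by_cases hb : b n ω = true
  · rw [if_pos hb, Set.indicator_of_mem (show ω ∈ {ω | b n ω = true} from hb)]
  · rw [if_neg hb, Set.indicator_of_notMem (show ω ∉ {ω | b n ω = true} from hb)]

end

/-- The density of the sum vanishes at 0 and to its left, so quotients by `v` may be simplified as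
if `v > 0`. -/
theorem lintegral_add_expMeasure_prod_congr {r : ℝ} (hr : 0 < r) {g g' : ℝ → ℝ≥0∞}
    (hg : Measurable g) (hg' : Measurable g') (h : ∀ v, 0 < v → g v = g' v) :
    ∫⁻ z, g (z.1 + z.2) ∂((expMeasure r).prod (expMeasure r)) =
      ∫⁻ z, g' (z.1 + z.2) ∂((expMeasure r).prod (expMeasure r)) := by
  rw [lintegral_add_expMeasure_prod hr hg, lintegral_add_expMeasure_prod hr hg']
  refine setLIntegral_congr_fun measurableSet_Ici fun v hv => ?_
  rcases (Set.mem_Ici.1 hv).eq_or_lt with rfl | hv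
  · simp
  · simp only [h v hv]

/-- The process almost surely has infinitely many points, so its enumeration uses every index. -/
theorem AreIndepThinnings.exists_indepMarks {Ω : Type*} [MeasurableSpace Ω] {P : Measure Ω}
    {X : Ω → PointPattern} {ρ p : ℝ} {m : ℕ} {Y : Fin m → Ω → PointPattern}
    (hY : AreIndepThinnings P X p Y) (hX : IsHomPoissonProcess P X ρ) (hρ : 0 < ρ) (i : Fin m) :
    ∃ (ξ : ℕ → Ω → ℝ) (b : ℕ → Ω → Bool), AreIndepMarks P ξ b p ∧
      (∀ᵐ ω ∂P, (Function.Injective fun n => ξ n ω) ∧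
        (X ω).carrier = Set.range fun n => ξ n ω) ∧
      ∀ᵐ ω ∂P, (Y i ω).carrier = (fun n => ξ n ω) '' {k | b k ω = true} := by
  obtain ⟨ξ, B, hξ, hB, hBp, hBi, hind, hae⟩ := hY.exists_marks
  have huniv {ω : Ω} (hω : (X ω).carrier.Infinite) :
      {n : ℕ | (n : ℕ∞) < (X ω).carrier.encard} = Set.univ := by
    rw [hω.encard_eq]; ext n; simp
  have hinj : Function.Injective fun n : ℕ => (i, n) := fun a b h => (Prod.ext_iff.1 h).2
  refine ⟨ξ, fun n => B (i, n), ⟨hξ, fun n => hB _, fun n => hBp _, hBi.precomp hinj, ?_⟩, ?_, ?_⟩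
  · exact hind.comp (φ := Prod.snd) (ψ := fun β n => β (i, n)) measurable_snd
      (measurable_pi_lambda _ fun n => measurable_pi_apply _)
  · filter_upwards [hae, hX.ae_infinite hρ] with ω ⟨h1, h2, _⟩ hω
    rw [huniv hω] at h1 h2
    exact ⟨Set.injOn_univ.1 h1, by rw [← h2, Set.image_univ]⟩
  · filter_upwards [hae, hX.ae_infinite hρ] with ω ⟨_, _, h3⟩ hω
    rw [h3 i]
    congr 1
    ext n
    have := Set.eq_univ_iff_forall.1 (huniv hω) n
    exact ⟨fun h => h.2, fun h => ⟨this, h⟩⟩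

/-! ### The typical cell -/

section

variable {Ω : Type*} [MeasurableSpace Ω] {P : Measure Ω} [IsProbabilityMeasure P]
  {X Y : Ω → PointPattern} {ρ p : ℝ} {ξ : ℕ → Ω → ℝ} {b : ℕ → Ω → Bool}

theorem lintegral_count_inter_cellSize (hX : IsHomPoissonProcess P X ρ) (hρ : 0 < ρ)
    (hm : AreIndepMarks P ξ b p) (hp : 0 < p) (hp1 : p ≤ 1)
    (hξ : ∀ᵐ ω ∂P, (Function.Injective fun n => ξ n ω) ∧
      (X ω).carrier = Set.range fun n => ξ n ω)
    (hY : ∀ᵐ ω ∂P, (Y ω).carrier = (fun n => ξ n ω) '' {k | b k ω = true})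
    {W : Set ℝ} (hW : MeasurableSet W) (hWb : Bornology.IsBounded W) {A : Set ℝ}
    (hA : MeasurableSet A) :
    ∫⁻ ω, ((Y ω).count (W ∩ {x | (Y ω).cellSize x ∈ A}) : ℝ≥0∞) ∂P =
      ENNReal.ofReal (p * ρ) * volume W * gammaMeasure 2 (2 * (p * ρ)) A := by
  classical
  have hS : MeasurableSet {z : ℝ × ℝ | (z.1 + z.2) / 2 ∈ A} := hA.preimage (by fun_prop)
  have hh : Measurable fun z : ℝ × ℝ × ℝ => W.indicator (1 : ℝ → ℝ≥0∞) z.1 *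
      {z : ℝ × ℝ | (z.1 + z.2) / 2 ∈ A}.indicator 1 z.2 :=
    ((measurable_one.indicator hW).comp measurable_fst).mul
      ((measurable_one.indicator hS).comp measurable_snd)
  have key := lintegral_tsum_point_gaps hX hρ hm hp hp1 hξ hh
  have hr : ∫⁻ z : ℝ × ℝ, ∫⁻ x, W.indicator (1 : ℝ → ℝ≥0∞) x *
      {z : ℝ × ℝ | (z.1 + z.2) / 2 ∈ A}.indicator 1 z
      ∂volume ∂((expMeasure (p * ρ)).prod (expMeasure (p * ρ))) =
      volume W * gammaMeasure 2 (2 * (p * ρ)) A := by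
    rw [← expMeasure_prod_half_add (by positivity) hA, ← lintegral_indicator_one hW,
      ← lintegral_indicator_one hS, ← lintegral_const_mul _ (measurable_one.indicator hS)]
    refine lintegral_congr fun z => ?_
    rw [lintegral_mul_const _ (measurable_one.indicator hW)]
  rw [mul_assoc, ← hr, ← key]
  refine lintegral_congr_ae ?_
  filter_upwards [hξ, hY, ae_gaps_ne_top hX hρ hm hp hp1 hξ] with ω hω hYω hgap
  rw [PointPattern.count_eq_tsum hω.1 hYω (hWb.subset Set.inter_subset_left)]
  refine tsum_congr fun n => ?_
  by_cases hb : b n ω = true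
  · have hcell := PointPattern.cellSize_eq hYω (hgap n hb).1 (hgap n hb).2
    simp only [Set.indicator, Set.mem_ofPred_eq, Set.mem_inter_iff, hb, if_true, hcell, true_and,
      Pi.one_apply]
    split_ifs <;> simp_all
  · rw [if_neg hb, Set.indicator_of_notMem (fun h => hb h.1)]

theorem isTypicalCellSizeLaw_gammaMeasure (hX : IsHomPoissonProcess P X ρ) (hρ : 0 < ρ)
    (hm : AreIndepMarks P ξ b p) (hp : 0 < p) (hp1 : p ≤ 1)
    (hξ : ∀ᵐ ω ∂P, (Function.Injective fun n => ξ n ω) ∧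
      (X ω).carrier = Set.range fun n => ξ n ω)
    (hY : ∀ᵐ ω ∂P, (Y ω).carrier = (fun n => ξ n ω) '' {k | b k ω = true}) :
    IsTypicalCellSizeLaw P Y (gammaMeasure 2 (2 * p * ρ)) := by
  have hprob : IsProbabilityMeasure (gammaMeasure 2 (2 * (p * ρ))) :=
    isProbabilityMeasure_gammaMeasure two_pos (by positivity)
  have hmean {W : Set ℝ} (hW : MeasurableSet W) (hWb : Bornology.IsBounded W) :
      ∫⁻ ω, ((Y ω).count W : ℝ≥0∞) ∂P = ENNReal.ofReal (p * ρ) * volume W := by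
    -- With no restriction on the cell size the gamma factor is 1, which leaves the mean count.
    have := lintegral_count_inter_cellSize hX hρ hm hp hp1 hξ hY hW hWb MeasurableSet.univ
    simpa using this
  rw [mul_assoc]
  refine ⟨hprob, fun W hW hWb h0 => ?_, fun W hW hWb _ => ?_, fun W hW hWb _ A hA => ?_⟩
  · rw [hmean hW hWb]
    exact ENNReal.mul_pos (by simpa using mul_pos hp hρ) h0.ne'
  · rw [hmean hW hWb]
    exact ENNReal.mul_lt_top ENNReal.ofReal_lt_top hWb.measure_lt_top
  · rw [hmean hW hWb, lintegral_count_inter_cellSize hX hρ hm hp hp1 hξ hY hW hWb hA]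

/-! ### Moments of the estimator at a fixed location -/

/-- For given gaps only two positions of the point put `u` at an end of its cell, a Lebesgue null
set; the expected number of such points is therefore 0. -/
theorem ae_ne_cell_boundary (hX : IsHomPoissonProcess P X ρ) (hρ : 0 < ρ)
    (hm : AreIndepMarks P ξ b p) (hp : 0 < p) (hp1 : p ≤ 1)
    (hξ : ∀ᵐ ω ∂P, (Function.Injective fun n => ξ n ω) ∧
      (X ω).carrier = Set.range fun n => ξ n ω) (u : ℝ) :
    ∀ᵐ ω ∂P, ∀ n, b n ω = true →
      u ≠ ξ n ω - (leftGap (fun k => ξ k ω) (fun k => b k ω) n).toReal / 2 ∧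
      u ≠ ξ n ω + (rightGap (fun k => ξ k ω) (fun k => b k ω) n).toReal / 2 := by
  classical
  let S : Set (ℝ × ℝ × ℝ) := {z | u = z.1 - z.2.1 / 2} ∪ {z | u = z.1 + z.2.2 / 2}
  have hS : MeasurableSet S :=
    (measurableSet_eq_fun (by fun_prop) (by fun_prop)).union
      (measurableSet_eq_fun (by fun_prop) (by fun_prop))
  have hh : Measurable (S.indicator (1 : ℝ × ℝ × ℝ → ℝ≥0∞)) := measurable_one.indicator hS
  have key := lintegral_tsum_point_gaps hX hρ hm hp hp1 hξ hh
  have hz : ∫⁻ z, ∫⁻ x, S.indicator (1 : ℝ × ℝ × ℝ → ℝ≥0∞) (x, z) ∂volume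
      ∂((expMeasure (p * ρ)).prod (expMeasure (p * ρ))) = 0 := by
    rw [lintegral_eq_zero_of_ae_eq_zero]
    refine Filter.Eventually.of_forall fun z => lintegral_eq_zero_of_ae_eq_zero ?_
    have h1 : ∀ᵐ x : ℝ, x ≠ u + z.1 / 2 := by simp [ae_iff]
    have h2 : ∀ᵐ x : ℝ, x ≠ u - z.2 / 2 := by simp [ae_iff]
    filter_upwards [h1, h2] with x h1 h2
    refine Set.indicator_of_notMem ?_ _
    rintro (h | h)
    · exact h1 (by have : u = x - z.1 / 2 := h
                   linarith)
    · exact h2 (by have : u = x + z.2 / 2 := h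
                   linarith)
  rw [hz, mul_zero, lintegral_eq_zero_iff
    (Measurable.tsum fun n => measurable_ite_point_gaps hm hh n)] at key
  filter_upwards [key] with ω hω n hn
  have h0 := ENNReal.tsum_eq_zero.1 hω n
  rw [if_pos hn] at h0
  rw [← not_or]
  intro h
  rw [Set.indicator_of_mem (show _ ∈ S from h)] at h0
  exact one_ne_zero h0

theorem ae_apply_voronoiEstimator (hX : IsHomPoissonProcess P X ρ) (hρ : 0 < ρ)
    (hm : AreIndepMarks P ξ b p) (hp : 0 < p) (hp1 : p ≤ 1)
    (hξ : ∀ᵐ ω ∂P, (Function.Injective fun n => ξ n ω) ∧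
      (X ω).carrier = Set.range fun n => ξ n ω)
    (hY : ∀ᵐ ω ∂P, (Y ω).carrier = (fun n => ξ n ω) '' {k | b k ω = true})
    {c : PointPattern → ℝ → ℝ} (hc : IsCellRule c) (u : ℝ) {f : ℝ → ℝ≥0∞} (hf : f 0 = 0) :
    ∀ᵐ ω ∂P, f (voronoiEstimator c (Y ω) u) = ∑' n, if b n ω = true then
      (fun z : ℝ × ℝ × ℝ => (if z.1 - z.2.1 / 2 ≤ u ∧ u ≤ z.1 + z.2.2 / 2 then
        f (2 / (z.2.1 + z.2.2)) else 0))
        (ξ n ω, (leftGap (fun k => ξ k ω) (fun k => b k ω) n).toReal,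
          (rightGap (fun k => ξ k ω) (fun k => b k ω) n).toReal) else 0 := by
  filter_upwards [hξ, hY, ae_gaps_ne_top hX hρ hm hp hp1 hξ,
    ae_ne_cell_boundary hX hρ hm hp hp1 hξ u] with ω hω hYω hgap hu
  exact PointPattern.apply_voronoiEstimator_eq_tsum hc hω.1 hYω hgap hu hf

theorem measurable_cell_indicator (u : ℝ) {f : ℝ → ℝ≥0∞} (hf : Measurable f) :
    Measurable fun z : ℝ × ℝ × ℝ => (if z.1 - z.2.1 / 2 ≤ u ∧ u ≤ z.1 + z.2.2 / 2 then
      f (2 / (z.2.1 + z.2.2)) else 0) :=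
  have h1 : MeasurableSet {z : ℝ × ℝ × ℝ | z.1 - z.2.1 / 2 ≤ u} :=
    measurableSet_le (by fun_prop) (by fun_prop)
  have h2 : MeasurableSet {z : ℝ × ℝ × ℝ | u ≤ z.1 + z.2.2 / 2} :=
    measurableSet_le (by fun_prop) (by fun_prop)
  Measurable.ite (h1.inter h2) (by fun_prop) measurable_const

/-- The second factor is a size bias: for given gaps, the positions whose cell covers `u` form an
interval as long as the cell. -/
theorem lintegral_apply_voronoiEstimator (hX : IsHomPoissonProcess P X ρ) (hρ : 0 < ρ)
    (hm : AreIndepMarks P ξ b p) (hp : 0 < p) (hp1 : p ≤ 1)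
    (hξ : ∀ᵐ ω ∂P, (Function.Injective fun n => ξ n ω) ∧
      (X ω).carrier = Set.range fun n => ξ n ω)
    (hY : ∀ᵐ ω ∂P, (Y ω).carrier = (fun n => ξ n ω) '' {k | b k ω = true})
    {c : PointPattern → ℝ → ℝ} (hc : IsCellRule c) (u : ℝ) {f : ℝ → ℝ≥0∞} (hf : Measurable f)
    (hf0 : f 0 = 0) :
    ∫⁻ ω, f (voronoiEstimator c (Y ω) u) ∂P = ENNReal.ofReal (p * ρ) *
      ∫⁻ z, f (2 / (z.1 + z.2)) * ENNReal.ofReal ((z.1 + z.2) / 2)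
        ∂((expMeasure (p * ρ)).prod (expMeasure (p * ρ))) := by
  classical
  rw [lintegral_congr_ae (ae_apply_voronoiEstimator hX hρ hm hp hp1 hξ hY hc u hf0),
    lintegral_tsum_point_gaps hX hρ hm hp hp1 hξ (measurable_cell_indicator u hf)]
  congr 1
  refine lintegral_congr fun z => ?_
  have hind (x : ℝ) : (if x - z.1 / 2 ≤ u ∧ u ≤ x + z.2 / 2 then f (2 / (z.1 + z.2)) else 0) =
      (Set.Icc (u - z.2 / 2) (u + z.1 / 2)).indicator (fun _ => f (2 / (z.1 + z.2))) x := by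
    by_cases hx : x ∈ Set.Icc (u - z.2 / 2) (u + z.1 / 2)
    · rw [Set.indicator_of_mem hx, if_pos ⟨by linarith [hx.2], by linarith [hx.1]⟩]
    · rw [Set.indicator_of_notMem hx, if_neg]
      exact fun h => hx ⟨by linarith [h.2], by linarith [h.1]⟩
  simp only [hind]
  rw [lintegral_indicator measurableSet_Icc, setLIntegral_const, Real.volume_Icc]
  congr 2
  ring

theorem lintegral_voronoiEstimator (hX : IsHomPoissonProcess P X ρ) (hρ : 0 < ρ)
    (hm : AreIndepMarks P ξ b p) (hp : 0 < p) (hp1 : p ≤ 1)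
    (hξ : ∀ᵐ ω ∂P, (Function.Injective fun n => ξ n ω) ∧
      (X ω).carrier = Set.range fun n => ξ n ω)
    (hY : ∀ᵐ ω ∂P, (Y ω).carrier = (fun n => ξ n ω) '' {k | b k ω = true})
    {c : PointPattern → ℝ → ℝ} (hc : IsCellRule c) (u : ℝ) :
    ∫⁻ ω, ENNReal.ofReal (voronoiEstimator c (Y ω) u) ∂P = ENNReal.ofReal (p * ρ) := by
  have := isProbabilityMeasure_expMeasure (r := p * ρ) (by positivity)
  rw [lintegral_apply_voronoiEstimator hX hρ hm hp hp1 hξ hY hc u ENNReal.measurable_ofReal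
    ENNReal.ofReal_zero, lintegral_add_expMeasure_prod_congr (by positivity)
    (g := fun v => ENNReal.ofReal (2 / v) * ENNReal.ofReal (v / 2)) (g' := fun _ => 1)
    (by fun_prop) (by fun_prop)]
  · simp
  · intro v hv
    rw [← ENNReal.ofReal_mul (by positivity), ← ENNReal.ofReal_one]
    congr 1
    field_simp

/-- The size bias reduces `1/V^2` to `1/V = 2/(L + R)`, whose mean is `2 p ρ`. -/
theorem lintegral_voronoiEstimator_sq (hX : IsHomPoissonProcess P X ρ) (hρ : 0 < ρ)
    (hm : AreIndepMarks P ξ b p) (hp : 0 < p) (hp1 : p ≤ 1)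
    (hξ : ∀ᵐ ω ∂P, (Function.Injective fun n => ξ n ω) ∧
      (X ω).carrier = Set.range fun n => ξ n ω)
    (hY : ∀ᵐ ω ∂P, (Y ω).carrier = (fun n => ξ n ω) '' {k | b k ω = true})
    {c : PointPattern → ℝ → ℝ} (hc : IsCellRule c) (u : ℝ) :
    ∫⁻ ω, ENNReal.ofReal (voronoiEstimator c (Y ω) u ^ 2) ∂P =
      ENNReal.ofReal (2 * (p * ρ) ^ 2) := by
  rw [lintegral_apply_voronoiEstimator hX hρ hm hp hp1 hξ hY hc u
    (f := fun v => ENNReal.ofReal (v ^ 2)) (by fun_prop) (by simp),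
    lintegral_add_expMeasure_prod_congr (by positivity)
    (g := fun v => ENNReal.ofReal ((2 / v) ^ 2) * ENNReal.ofReal (v / 2))
    (g' := fun v => ENNReal.ofReal 2 * ENNReal.ofReal (1 / v)) (by fun_prop) (by fun_prop),
    lintegral_const_mul' _ _ ENNReal.ofReal_ne_top,
    lintegral_inv_add_expMeasure_prod (by positivity), ← ENNReal.ofReal_mul (by positivity),
    ← ENNReal.ofReal_mul (by positivity)]
  · congr 1; ring
  · intro v hv
    rw [← ENNReal.ofReal_mul (by positivity), ← ENNReal.ofReal_mul (by positivity)]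
    congr 1
    field_simp

theorem voronoiEstimator_nonneg (c : PointPattern → ℝ → ℝ) (s : PointPattern) (u : ℝ) :
    0 ≤ voronoiEstimator c s u := by
  unfold voronoiEstimator PointPattern.cellSize
  split_ifs <;> positivity

/-- The cell rule need not be measurable, but the estimator agrees almost surely with a measurable
sum over marked points. -/
theorem aemeasurable_voronoiEstimator (hX : IsHomPoissonProcess P X ρ) (hρ : 0 < ρ)
    (hm : AreIndepMarks P ξ b p) (hp : 0 < p) (hp1 : p ≤ 1)
    (hξ : ∀ᵐ ω ∂P, (Function.Injective fun n => ξ n ω) ∧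
      (X ω).carrier = Set.range fun n => ξ n ω)
    (hY : ∀ᵐ ω ∂P, (Y ω).carrier = (fun n => ξ n ω) '' {k | b k ω = true})
    {c : PointPattern → ℝ → ℝ} (hc : IsCellRule c) (u : ℝ) :
    AEMeasurable (fun ω => voronoiEstimator c (Y ω) u) P := by
  classical
  refine ⟨_, (Measurable.tsum (L := .unconditional ℕ) fun n => measurable_ite_point_gaps hm
    (measurable_cell_indicator u ENNReal.measurable_ofReal) n).ennreal_toReal, ?_⟩
  filter_upwards [ae_apply_voronoiEstimator hX hρ hm hp hp1 hξ hY hc u ENNReal.ofReal_zero]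
    with ω hω
  rw [← hω, ENNReal.toReal_ofReal (voronoiEstimator_nonneg c _ u)]

/-! ### Variances and averaging -/

theorem memLp_and_moments_of_lintegral {Z : Ω → ℝ} (hZ : AEMeasurable Z P) (h0 : ∀ ω, 0 ≤ Z ω)
    {a a2 : ℝ} (ha : 0 ≤ a) (ha2 : 0 ≤ a2)
    (h1 : ∫⁻ ω, ENNReal.ofReal (Z ω) ∂P = ENNReal.ofReal a)
    (h2 : ∫⁻ ω, ENNReal.ofReal (Z ω ^ 2) ∂P = ENNReal.ofReal a2) :
    MemLp Z 2 P ∧ P[Z] = a ∧ Var[Z; P] = a2 - a ^ 2 := by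
  have hL : MemLp Z 2 P := by
    rw [memLp_two_iff_integrable_sq hZ.aestronglyMeasurable]
    refine ⟨(hZ.pow_const 2).aestronglyMeasurable, ?_⟩
    rw [hasFiniteIntegral_iff_ofReal (Filter.Eventually.of_forall fun ω => sq_nonneg _), h2]
    exact ENNReal.ofReal_lt_top
  have hE : P[Z] = a := by
    rw [integral_eq_lintegral_of_nonneg_ae (Filter.Eventually.of_forall h0)
      hZ.aestronglyMeasurable, h1, ENNReal.toReal_ofReal ha]
  have hE2 : P[Z ^ 2] = a2 := by
    simp only [Pi.pow_apply]
    rw [integral_eq_lintegral_of_nonneg_ae (Filter.Eventually.of_forall fun ω => sq_nonneg _)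
      (hZ.pow_const 2).aestronglyMeasurable, h2, ENNReal.toReal_ofReal ha2]
  exact ⟨hL, hE, by rw [variance_eq_sub hL, hE, hE2]⟩

/-- Cauchy–Schwarz bounds the squared deviation of the average pointwise by the average of the
squared deviations from the common mean, so nothing about the joint law is needed. -/
theorem variance_average_le {m : ℕ} (hm : 1 ≤ m) {T : Fin m → Ω → ℝ} {a v : ℝ}
    (hT : ∀ i, MemLp (T i) 2 P) (hE : ∀ i, P[T i] = a) (hV : ∀ i, Var[T i; P] = v) :
    MemLp (fun ω => (1 / (m : ℝ)) * ∑ i, T i ω) 2 P ∧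
      Var[fun ω => (1 / (m : ℝ)) * ∑ i, T i ω; P] ≤ v := by
  have hm0 : (0 : ℝ) < m := by exact_mod_cast hm
  have hL : MemLp (fun ω => (1 / (m : ℝ)) * ∑ i, T i ω) 2 P :=
    (memLp_finsetSum _ fun i _ => hT i).const_mul _
  have hEavg : ∫ ω, (1 / (m : ℝ)) * ∑ i, T i ω ∂P = a := by
    rw [integral_const_mul, integral_finsetSum _ fun i _ => (hT i).integrable one_le_two]
    simp only [hE, Finset.sum_const, Finset.card_univ, Fintype.card_fin, nsmul_eq_mul]
    field_simp
  have hsq (i : Fin m) : Integrable (fun ω => (T i ω - a) ^ 2) P :=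
    ((hT i).sub (memLp_const a)).integrable_sq
  refine ⟨hL, ?_⟩
  rw [variance_eq_integral hL.aestronglyMeasurable.aemeasurable, hEavg]
  calc ∫ ω, ((1 / (m : ℝ)) * ∑ i, T i ω - a) ^ 2 ∂P
      ≤ ∫ ω, (1 / (m : ℝ)) * ∑ i, (T i ω - a) ^ 2 ∂P := by
        refine integral_mono (hL.sub (memLp_const a)).integrable_sq
          ((integrable_finsetSum _ fun i _ => hsq i).const_mul _) fun ω => ?_
        have hcs := sq_sum_le_card_mul_sum_sq (s := Finset.univ) (f := fun i => T i ω - a)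
        rw [Finset.sum_sub_distrib] at hcs
        simp only [Finset.sum_const, Finset.card_univ, Fintype.card_fin, nsmul_eq_mul] at hcs
        have e : (1 / (m : ℝ)) * ∑ i, T i ω - a = (1 / (m : ℝ)) * (∑ i, T i ω - m * a) := by
          field_simp
        change ((1 / (m : ℝ)) * ∑ i, T i ω - a) ^ 2 ≤ (1 / (m : ℝ)) * ∑ i, (T i ω - a) ^ 2
        rw [e, mul_pow]
        calc (1 / (m : ℝ)) ^ 2 * (∑ i, T i ω - m * a) ^ 2
            ≤ (1 / (m : ℝ)) ^ 2 * (m * ∑ i, (T i ω - a) ^ 2) := by gcongr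
          _ = _ := by field_simp
    _ = v := by
        rw [integral_const_mul, integral_finsetSum _ fun i _ => hsq i]
        have hi (i : Fin m) : ∫ ω, (T i ω - a) ^ 2 ∂P = v := by
          rw [← hV i, variance_eq_integral (hT i).aestronglyMeasurable.aemeasurable, hE i]
        simp only [hi, Finset.sum_const, Finset.card_univ, Fintype.card_fin, nsmul_eq_mul]
        field_simp

end

theorem lemma2 {Ω : Type*} [MeasurableSpace Ω] (P : Measure Ω) [IsProbabilityMeasure P]
    (ρ : ℝ) (hρ : 0 < ρ) (p : ℝ) (hp0 : 0 < p) (hp1 : p ≤ 1) (m : ℕ) (hm : 1 ≤ m)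
    (X : Ω → PointPattern) (hX : IsHomPoissonProcess P X ρ)
    (Y : Fin m → Ω → PointPattern) (hY : AreIndepThinnings P X p Y)
    (c : PointPattern → ℝ → ℝ) (hc : IsCellRule c) :
    (∀ i, IsTypicalCellSizeLaw P (Y i) (gammaMeasure 2 (2 * p * ρ))) ∧
    ∀ u : ℝ,
      MemLp (fun ω => resampleEstimator c p (fun i => Y i ω) u) 2 P ∧
      ∀ j : Fin m,
        MemLp (fun ω => resampleEstimator c p (fun _ : Fin 1 => Y j ω) u) 2 P ∧
        Var[fun ω => resampleEstimator c p (fun i => Y i ω) u; P] ≤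
          Var[fun ω => resampleEstimator c p (fun _ : Fin 1 => Y j ω) u; P] ∧
        Var[fun ω => resampleEstimator c p (fun _ : Fin 1 => Y j ω) u; P] = ρ ^ 2 := by
  refine ⟨fun i => ?_, fun u => ?_⟩
  · obtain ⟨ξ, b, hmk, hξ, hYi⟩ := hY.exists_indepMarks hX hρ i
    exact isTypicalCellSizeLaw_gammaMeasure hX hρ hmk hp0 hp1 hξ hYi
  have hmom (i : Fin m) : MemLp (fun ω => voronoiEstimator c (Y i ω) u / p) 2 P ∧
      P[fun ω => voronoiEstimator c (Y i ω) u / p] = ρ ∧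
      Var[fun ω => voronoiEstimator c (Y i ω) u / p; P] = ρ ^ 2 := by
    obtain ⟨ξ, b, hmk, hξ, hYi⟩ := hY.exists_indepMarks hX hρ i
    obtain ⟨hL, hE, hV⟩ := memLp_and_moments_of_lintegral
      (aemeasurable_voronoiEstimator hX hρ hmk hp0 hp1 hξ hYi hc u)
      (fun ω => voronoiEstimator_nonneg c _ u) (by positivity) (by positivity)
      (lintegral_voronoiEstimator hX hρ hmk hp0 hp1 hξ hYi hc u)
      (lintegral_voronoiEstimator_sq hX hρ hmk hp0 hp1 hξ hYi hc u)
    simp only [div_eq_inv_mul]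
    refine ⟨hL.const_mul _, ?_, ?_⟩
    · rw [integral_const_mul, hE]; field_simp
    -- The variance before scaling is `2(pρ)^2 - (pρ)^2`; division by `p^2` leaves `ρ^2`.
    · rw [variance_const_mul, hV]; field_simp; ring
  have hsingle (j : Fin m) : (fun ω => resampleEstimator c p (fun _ : Fin 1 => Y j ω) u) =
      fun ω => voronoiEstimator c (Y j ω) u / p := by
    ext ω; simp [resampleEstimator]
  obtain ⟨hL, hV⟩ := variance_average_le hm (fun i => (hmom i).1) (fun i => (hmom i).2.1)
    (fun i => (hmom i).2.2)
  refine ⟨hL, fun j => ?_⟩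
  rw [hsingle j, (hmom j).2.2]
  exact ⟨(hmom j).1, hV, rfl⟩
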